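/- There is an absolute constant $\varepsilon_0>0$ such that the following two statements hold. **Model.** Nodes are $1,\dots,n$ and $\log$ is the natural logarithm. In every round $t\ge 1$ a matching $\mathbf{M}^{(t)}$ of a graph $G$ on these nodes is applied to the integer load vector $x^{(t-1)}$. For every matched pair $\{u,v\}$, one of $u,v$, chosen by an independent fair coin, gets $\lceil (x^{(t-1)}_u+x^{(t-1)}_v)/2\rceil$ tokens and the other one gets $\lfloor (x^{(t-1)}_u+x^{(t-1)}_v)/2\rfloor$ tokens; unmatched nodes keep their load. The result is $x^{(t)}$. The matching matrix of $\mathbf{M}^{(t)}$ has, for each matched pair $\{u,v\}$, entries $1/2$ at $(u,u),(v,v),(u,v),(v,u)$, has $1$ at $(u,u)$ for every unmatched $u$, and has $0$ elsewhere. For a real symmetric matrix $A$ with eigenvalues $\lambda_1(A)\ge\dots\ge\lambda_n(A)$ put $\lambda(A)=\max\{|\lambda_2(A)|,|\lambda_n(A)|\}$. **(a) Random matching model.** For every $p>0$ there are constants $C>0$ and $N$ such that the following holds for all $0<\varepsilon<\varepsilon_0$, all $n\ge N$, and every connected $d$-regular graph $G$ with $n$ nodes. Let the matchings of different rounds be random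 matchings of $G$ that are mutually independent and independent of the coins, not necessarily identically distributed, such that in every round every edge of $G$ is in the matching with probability at least $p/d$. Let $\mathbf{P}$ be the diffusion matrix of $G$, i.e. $\mathbf{P}_{u,v}=\frac1{2d}$ for $\{u,v\}\in E(G)$, $\mathbf{P}_{u,u}=\frac12$, and $0$ otherwise. If $x^{(0)}$ is a non-negative integer vector with $\|x^{(0)}\|_1\le n\,e^{-(\log n)^{1-\varepsilon}}$, then for every integer $\kappa\ge C\,\frac{\log n}{1-\lambda(\mathbf{P})}$ we have $\|x^{(\kappa)}\|_\infty\le 1$ with probability at least $1-5n^{-1}$. **(b) Balancing circuit model.** For every integer $d\ge1$ there are constants $C>0$ and $N$ such that the following holds for all $0<\varepsilon<\varepsilon_0$, all $n\ge N$, every graph $G$ with $n$ nodes and every sequence $\mathbf{M}^{(1)},\dots,\mathbf{M}^{(d)}$ of matchings of $G$ that is applied periodically. Let $\mathbf{M}=\mathbf{M}^{(1)}\cdots\mathbf{M}^{(d)}$ be the round matrix. If $\mathbf{M}$ is not symmetric, let $\lambda(\mathbf{M})$ denote its second largest singular value (for symmetric $\mathbf{M}$ this equals the $\lambda(\mathbf{M})$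 defined above). Assume $\lambda(\mathbf{M})<1$. If $x^{(0)}$ is a non-negative integer vector with $\|x^{(0)}\|_1\le n\,e^{-(\log n)^{1-\varepsilon}}$, then for every integer $\kappa\ge C\,\frac{\log n}{1-\lambda(\mathbf{M})}$ we have $\|x^{(\kappa)}\|_\infty\le 1$ with probability at least $1-5n^{-1}$. -/

import Mathlib

noncomputable section

namespace MatchingModel

/-- For a real symmetric matrix with eigenvalues `λ₁ ≥ … ≥ λₙ` (with multiplicity, `n ≥ 2`), this is
`λ(A) = max {|λ₂|, |λₙ|}`. -/
def lam {n : ℕ} (A : Matrix (Fin n) (Fin n) ℝ) (hA : A.IsHermitian) : ℝ :=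
  if h : 2 ≤ n then
    max |hA.eigenvalues₀ ⟨1, by rw [Fintype.card_fin]; omega⟩|
      |hA.eigenvalues₀ ⟨n - 1, by rw [Fintype.card_fin]; omega⟩|
  else 0

/-- The diffusion matrix: `1 / (2Δ)` on edges, `1 - deg u / (2Δ)` on the diagonal, `0` elsewhere. -/
def diffusionMatrix {n : ℕ} (G : SimpleGraph (Fin n)) [DecidableRel G.Adj] :
    Matrix (Fin n) (Fin n) ℝ :=
  Matrix.of fun u v =>
    if u = v then 1 - (G.degree u : ℝ) / (2 * (G.maxDegree : ℝ))
    else if G.Adj u v then 1 / (2 * (G.maxDegree : ℝ)) else 0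

theorem diffusionMatrix_isHermitian {n : ℕ} (G : SimpleGraph (Fin n)) [DecidableRel G.Adj] :
    (diffusionMatrix G).IsHermitian := by
  ext u v
  by_cases h : u = v
  · subst h
    simp [diffusionMatrix]
  · simp [diffusionMatrix, h, Ne.symm h, G.adj_comm u v]

/-- The matchings of `G` (not necessarily perfect or maximal; the empty one is allowed). -/
abbrev Matching {n : ℕ} (G : SimpleGraph (Fin n)) : Type :=
  {M : G.Subgraph // M.IsMatching}

open Classical in
/-- The node matched with `u`, and `u` itself if `u` is not matched. -/
def partner {n : ℕ} {G : SimpleGraph (Fin n)} (M : Matching G) (u : Fin n) : Fin n :=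
  if h : u ∈ M.1.verts then (M.2 h).choose else u

/-- The matching matrix: matched nodes average their loads, unmatched nodes keep theirs. -/
def matchingMatrix {n : ℕ} {G : SimpleGraph (Fin n)} (M : Matching G) :
    Matrix (Fin n) (Fin n) ℝ :=
  Matrix.of fun u v =>
    if partner M u = u then (if v = u then 1 else 0)
    else if v = u ∨ v = partner M u then 1 / 2 else 0

/-- The round matrix `M⁽¹⁾ M⁽²⁾ ⋯ M⁽ᵈ⁾` of a balancing circuit. -/
def roundMatrix {n d : ℕ} {G : SimpleGraph (Fin n)} (M : Fin d → Matching G) :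
    Matrix (Fin n) (Fin n) ℝ :=
  (List.ofFn fun s => matchingMatrix (M s)).prod

open Classical in
/-- `λ` of a round matrix `A`: it is `max {|λ₂(A)|, |λₙ(A)|}` if `A` is symmetric. A product of
matching matrices need not be symmetric; otherwise `λ` is the second largest singular value of `A`,
that is, the square root of the second largest eigenvalue of `Aᵀ A` (for symmetric `A` this is
the same number, `A` being doubly stochastic). -/
def roundLam {n : ℕ} (A : Matrix (Fin n) (Fin n) ℝ) : ℝ :=
  if h : A.IsHermitian then lam A h
  else Real.sqrt (lam (A.conjTranspose * A) (Matrix.isHermitian_conjTranspose_mul_self A))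

/-- Coin flips of one round, one for every unordered pair of nodes. -/
abbrev Coins (n : ℕ) : Type := Sym2 (Fin n) → Bool

/-- The orientation of a matched pair `{u, v}`: the coin of the pair decides whether the smaller or
the larger node gets the excess token. -/
def GetsExcess {n : ℕ} (c : Coins n) (u v : Fin n) : Prop :=
  if u < v then c s(u, v) = true else c s(u, v) = false

open Classical in
/-- One round of the discrete protocol with matching `M` and coin flips `c`. -/
def balance {n : ℕ} {G : SimpleGraph (Fin n)} (M : Matching G) (c : Coins n) (x : Fin n → ℤ) :
    Fin n → ℤ := fun u =>
  if partner M u = u then x u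
  else if GetsExcess c u (partner M u) then ⌈((x u + x (partner M u) : ℤ) : ℝ) / 2⌉
  else ⌊((x u + x (partner M u) : ℤ) : ℝ) / 2⌋

/-- The law of the load vector at the end of round `t`, started in `x₀`: the matching of round
`t + 1` has law `μ t`, the coins are fair, and all matchings and coins are mutually independent. -/
def loadLaw {n : ℕ} {G : SimpleGraph (Fin n)} (μ : ℕ → PMF (Matching G)) (x₀ : Fin n → ℤ) :
    ℕ → PMF (Fin n → ℤ)
  | 0 => PMF.pure x₀
  | t + 1 => (loadLaw μ x₀ t).bind fun x => (μ t).bind fun M =>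
      (PMF.uniformOfFintype (Coins n)).map fun c => balance M c x

/-- The balancing circuit: the `d` matchings are applied periodically (deterministically). -/
def circuit {n d : ℕ} (hd : 0 < d) {G : SimpleGraph (Fin n)} (M : Fin d → Matching G) :
    ℕ → PMF (Matching G) :=
  fun t => PMF.pure (M ⟨t % d, Nat.mod_lt t hd⟩)

/-- Probability of an event under a discrete law. -/
def prob {α : Type*} (p : PMF α) (S : Set α) : ℝ := (p.toOuterMeasure S).toReal

/-- A non-negative integral load vector with `‖x‖₁ ≤ n exp (-(log n)^(1-ε))`. -/
def IsSparseLoad {n : ℕ} (ε : ℝ) (x : Fin n → ℤ) : Prop :=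
  (∀ u, 0 ≤ x u) ∧
    ((∑ u, |x u| : ℤ) : ℝ) ≤ (n : ℝ) * Real.exp (-(Real.log n) ^ (1 - ε))

end MatchingModel

end

/-! Call the tokens above the first one of each node the excess. All loads are at most 1 exactly
when the excess vanishes, so by Markov's inequality it is enough that the expected excess in round κ
is at most `5 / n`.

Contraction of the excess. Put `b = min x 1` and mark the tokens of `x - b`. Run `x` and `b` with
the same matchings and coins: by monotonicity `b` stays below `x` and below 1, so the later excess
is at most the number of pairs of a marked token and another token at the same node. In expectation
this number is no larger than for independent walkers driven by the same matchings: rounding errors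
of different matched pairs are uncorrelated, those within a pair are opposite, and the remaining
second-order term is paid for by the excluded self-pairs (`coinAvg_collisionBound_le`). Let `Q u v`
be the probability that two such walkers from `u` and `v` meet after `L` rounds. If every weighted
load `∑ v, x v * Q u v` is at most `η`, then `L` rounds shrink the expected excess by the factor `η`
(`expLoad_excess_le`).

Concentration. Product moments of the load are at most those of independent tokens
(`coinAvg_prod_pow_le`), so a Chernoff bound applies to a weighted load whose weights are at most
`β`. Once the matchings have mixed, its mean is at most twice the average load
(`expLoad_tailIndicator_le`).

Parameters. With `s = √(log n)`, sparsity gives average load at most `exp (-s)`. Phases of about `s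
/ γ` rounds make the entries of `Q` at most `β = 2 exp (-s)`, and `η = exp (-s / 2)` is exceeded
only with probability of order `n ^ (-5)`. About `6 s` phases reduce the excess by `n ^ (-3)`, and
the total time is of order `s ^ 2 / γ = log n / γ`.

The two models enter only through the mean-square contraction rate `γ` on vectors of sum zero,
obtained from the spectral gap. -/

namespace MatchingModel

/-! ### Matchings as involutions of the nodes -/

section Partner

variable {n : ℕ} {G : SimpleGraph (Fin n)} (M : Matching G)

theorem partner_eq_of_adj {u v : Fin n} (h : M.1.Adj u v) : partner M u = v := by
  have hu : u ∈ M.1.verts := M.1.edge_vert h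
  unfold partner
  rw [dif_pos hu]
  exact ((M.2 hu).choose_spec.2 v h).symm

theorem adj_partner {u : Fin n} (h : partner M u ≠ u) : M.1.Adj u (partner M u) := by
  by_cases hu : u ∈ M.1.verts
  · have : partner M u = (M.2 hu).choose := by unfold partner; rw [dif_pos hu]
    rw [this]
    exact (M.2 hu).choose_spec.1
  · exact absurd (by unfold partner; rw [dif_neg hu]) h

@[simp] theorem partner_partner (u : Fin n) : partner M (partner M u) = u := by
  by_cases h : partner M u = u
  · rw [h, h]
  · exact partner_eq_of_adj M (adj_partner M h).symm

/-- The involution of the nodes that swaps matched pairs. -/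
noncomputable def partnerEquiv : Fin n ≃ Fin n :=
  Function.Involutive.toPerm (partner M) (partner_partner M)

theorem sum_partner (f : Fin n → ℝ) : ∑ u, f (partner M u) = ∑ u, f u :=
  Equiv.sum_comp (partnerEquiv M) f

theorem matchingMatrix_mulVec (g : Fin n → ℝ) (u : Fin n) :
    (matchingMatrix M).mulVec g u = (g u + g (partner M u)) / 2 := by
  unfold matchingMatrix Matrix.mulVec dotProduct
  by_cases h : partner M u = u
  · simp [h]
  · have : ∀ v, (if v = u ∨ v = partner M u then (1 / 2 : ℝ) else 0) * g v
        = (if v = u then g v / 2 else 0) + (if v = partner M u then g v / 2 else 0) := by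
      intro v
      by_cases h1 : v = u
      · subst h1
        simp [Ne.symm h]; ring
      · by_cases h2 : v = partner M u
        · subst h2
          simp [h]; ring
        · simp [h1, h2]
    simp only [Matrix.of_apply, h, if_false]
    rw [Finset.sum_congr rfl fun v _ => this v, Finset.sum_add_distrib]
    simp; ring

theorem matchingMatrix_transpose : (matchingMatrix M).transpose = matchingMatrix M := by
  ext u v
  have key : v = partner M u ↔ u = partner M v := by
    constructor <;> (rintro rfl; simp)
  by_cases h : u = v
  · subst h; rfl
  · have h' : v ≠ u := Ne.symm h
    simp only [matchingMatrix, Matrix.transpose_apply, Matrix.of_apply, h, h', if_false, false_or]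
    by_cases hk : v = partner M u
    · have hk' := key.1 hk
      rw [← hk, ← hk']
      simp [h, h']
    · have hk' : ¬ u = partner M v := fun hh => hk (key.2 hh)
      simp [hk, hk']

/-- Averaging a kernel over the two coordinates of matched pairs. -/
theorem matchingMatrix_conj_apply (h : Matrix (Fin n) (Fin n) ℝ) (u v : Fin n) :
    (matchingMatrix M * h * matchingMatrix M) u v =
      (h u v + h (partner M u) v + h u (partner M v) + h (partner M u) (partner M v)) / 4 := by
  have h1 : ∀ w, (matchingMatrix M * h) u w = (h u w + h (partner M u) w) / 2 := fun w =>
    matchingMatrix_mulVec M (fun z => h z w) u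
  have h2 : ∀ A : Matrix (Fin n) (Fin n) ℝ, (A * matchingMatrix M) u v =
      (A u v + A u (partner M v)) / 2 := by
    intro A
    have := matchingMatrix_mulVec M (fun z => A u z) v
    rw [← this, Matrix.mul_apply, Matrix.mulVec, dotProduct]
    refine Finset.sum_congr rfl fun w _ => ?_
    have := congrFun (congrFun (matchingMatrix_transpose M) v) w
    rw [Matrix.transpose_apply] at this
    rw [this, mul_comm]
  rw [h2, h1, h1]
  ring

end Partner

/-! ### Fair coins and their correlations -/

section Coins

variable {n : ℕ}

open Classical in
/-- The sign of the coin of the pair `{u, v}` seen from `u`. -/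
noncomputable def coinSign (c : Coins n) (u v : Fin n) : ℝ := if GetsExcess c u v then 1 else -1

theorem coinSign_mul_self (c : Coins n) (u v : Fin n) : coinSign c u v * coinSign c u v = 1 := by
  unfold coinSign; split_ifs <;> norm_num

theorem getsExcess_swap (c : Coins n) {u v : Fin n} (h : u ≠ v) :
    GetsExcess c v u ↔ ¬ GetsExcess c u v := by
  unfold GetsExcess
  rw [Sym2.eq_swap (a := v)]
  rcases lt_or_gt_of_ne h with h1 | h1
  · simp [h1, h1.not_gt]
  · simp [h1, h1.not_gt]

theorem coinSign_swap (c : Coins n) {u v : Fin n} (h : u ≠ v) :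
    coinSign c v u = -coinSign c u v := by
  unfold coinSign
  by_cases h1 : GetsExcess c u v
  · simp [h1, getsExcess_swap c h]
  · simp [h1, getsExcess_swap c h]

/-- Flipping one coin. -/
def flipCoin (e : Sym2 (Fin n)) (c : Coins n) : Coins n := Function.update c e (!c e)

theorem flipCoin_involutive (e : Sym2 (Fin n)) : Function.Involutive (flipCoin e) := by
  intro c
  funext e'
  by_cases h : e' = e
  · subst h; simp [flipCoin]
  · simp [flipCoin, h]

theorem coinSign_flipCoin_self (c : Coins n) (u v : Fin n) :
    coinSign (flipCoin s(u, v) c) u v = -coinSign c u v := by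
  unfold coinSign GetsExcess flipCoin
  by_cases h : u < v <;> cases c s(u, v) <;> simp [h]

theorem coinSign_flipCoin_of_ne (c : Coins n) {e : Sym2 (Fin n)} {u v : Fin n} (h : s(u, v) ≠ e) :
    coinSign (flipCoin e c) u v = coinSign c u v := by
  unfold coinSign GetsExcess flipCoin
  simp [h]

theorem sum_flipCoin (e : Sym2 (Fin n)) (f : Coins n → ℝ) :
    ∑ c, f (flipCoin e c) = ∑ c, f c :=
  Equiv.sum_comp (Function.Involutive.toPerm _ (flipCoin_involutive e)) f

theorem sum_coinSign (u v : Fin n) : ∑ c : Coins n, coinSign c u v = 0 := by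
  have h := sum_flipCoin s(u, v) (fun c => coinSign c u v)
  simp only [coinSign_flipCoin_self, Finset.sum_neg_distrib] at h
  linarith

/-- Flipping the coin of one pair is an involution that negates one factor and fixes the other. -/
theorem sum_coinSign_mul {u v u' v' : Fin n} (h : s(u', v') ≠ s(u, v)) :
    ∑ c : Coins n, coinSign c u v * coinSign c u' v' = 0 := by
  have hh := sum_flipCoin s(u, v) (fun c => coinSign c u v * coinSign c u' v')
  simp only [coinSign_flipCoin_self, coinSign_flipCoin_of_ne _ h, neg_mul,
    Finset.sum_neg_distrib] at hh
  linarith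

/-- The average over all coin flips. -/
noncomputable def coinAvg (f : Coins n → ℝ) : ℝ := (∑ c, f c) / Fintype.card (Coins n)

theorem card_coins_pos : (0 : ℝ) < Fintype.card (Coins n) := by
  exact_mod_cast Fintype.card_pos

theorem coinAvg_mono {f g : Coins n → ℝ} (h : ∀ c, f c ≤ g c) : coinAvg f ≤ coinAvg g :=
  div_le_div_of_nonneg_right (Finset.sum_le_sum fun c _ => h c) card_coins_pos.le

@[simp] theorem coinAvg_const (a : ℝ) : coinAvg (fun _ : Coins n => a) = a := by
  have := (card_coins_pos (n := n)).ne'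
  simp only [coinAvg, Finset.sum_const, Finset.card_univ, nsmul_eq_mul]
  field_simp

theorem coinAvg_add (f g : Coins n → ℝ) :
    coinAvg (fun c => f c + g c) = coinAvg f + coinAvg g := by
  simp only [coinAvg, Finset.sum_add_distrib]; ring

theorem coinAvg_const_mul (a : ℝ) (f : Coins n → ℝ) :
    coinAvg (fun c => a * f c) = a * coinAvg f := by
  simp only [coinAvg, ← Finset.mul_sum]; ring

theorem coinAvg_sum {ι : Type*} (s : Finset ι) (f : ι → Coins n → ℝ) :
    coinAvg (fun c => ∑ i ∈ s, f i c) = ∑ i ∈ s, coinAvg (f i) := by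
  simp only [coinAvg]
  rw [Finset.sum_comm, Finset.sum_div]

theorem coinAvg_coinSign (u v : Fin n) : coinAvg (fun c => coinSign c u v) = 0 := by
  simp [coinAvg, sum_coinSign]

theorem coinAvg_coinSign_mul {u v u' v' : Fin n} (h : s(u', v') ≠ s(u, v)) :
    coinAvg (fun c => coinSign c u v * coinSign c u' v') = 0 := by
  simp [coinAvg, sum_coinSign_mul h]

end Coins

/-! ### One round: rounding errors, monotonicity, conservation -/

section Balance

variable {n : ℕ} {G : SimpleGraph (Fin n)} (M : Matching G)

theorem ceil_half (z : ℤ) : ⌈(z : ℝ) / 2⌉ = (z + 1) / 2 := by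
  rw [Int.ceil_eq_iff]
  rcases Int.even_or_odd' z with ⟨k, rfl | rfl⟩
  · rw [show (2 * k + 1) / 2 = k by omega]; push_cast; constructor <;> linarith
  · rw [show (2 * k + 1 + 1) / 2 = k + 1 by omega]; push_cast; constructor <;> linarith

theorem floor_half (z : ℤ) : ⌊(z : ℝ) / 2⌋ = z / 2 := by
  rw [Int.floor_eq_iff]
  rcases Int.even_or_odd' z with ⟨k, rfl | rfl⟩
  · rw [show (2 * k) / 2 = k by omega]; push_cast; constructor <;> linarith
  · rw [show (2 * k + 1) / 2 = k by omega]; push_cast; constructor <;> linarith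

-- An unmatched node is its own partner, and `x u + x u` is even, so the formula for matched nodes
-- covers it whatever its fictitious coin shows.
open Classical in
theorem balance_apply (c : Coins n) (x : Fin n → ℤ) (u : Fin n) :
    balance M c x u = if GetsExcess c u (partner M u) then (x u + x (partner M u) + 1) / 2
      else (x u + x (partner M u)) / 2 := by
  unfold balance
  rw [ceil_half, floor_half]
  by_cases h : partner M u = u
  · rw [if_pos h, h]
    split_ifs <;> omega
  · rw [if_neg h]

/-- The load after a round is the averaged load plus a centred rounding error. -/
theorem balance_eq_average (c : Coins n) (x : Fin n → ℤ) (u : Fin n) :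
    (balance M c x u : ℝ) = ((x u : ℝ) + x (partner M u)) / 2
      + coinSign c u (partner M u) * (((x u + x (partner M u)) % 2 : ℤ) : ℝ) / 2 := by
  rw [balance_apply]
  unfold coinSign
  generalize hz : x u + x (partner M u) = z
  have hz' : (x u : ℝ) + x (partner M u) = z := by rw [← hz]; push_cast; ring
  rw [hz']
  rcases Int.even_or_odd' z with ⟨k, hk | hk⟩
  · rw [show (z + 1) / 2 = k by omega, show z / 2 = k by omega, show z % 2 = 0 by omega, hk]
    split_ifs <;> push_cast <;> ring
  · rw [show (z + 1) / 2 = k + 1 by omega, show z / 2 = k by omega, show z % 2 = 1 by omega, hk]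
    split_ifs <;> push_cast <;> ring

/-- This is the coupling that keeps the unmarked tokens a subset of all tokens when both loads use
the same coins. -/
theorem balance_mono (c : Coins n) {x y : Fin n → ℤ} (h : ∀ u, x u ≤ y u) (u : Fin n) :
    balance M c x u ≤ balance M c y u := by
  rw [balance_apply, balance_apply]
  have h1 := h u
  have h2 := h (partner M u)
  split_ifs <;> omega

theorem balance_nonneg (c : Coins n) {x : Fin n → ℤ} (h : ∀ u, 0 ≤ x u) (u : Fin n) :
    0 ≤ balance M c x u := by
  rw [balance_apply]
  have h1 := h u
  have h2 := h (partner M u)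
  split_ifs <;> omega

theorem balance_le_one (c : Coins n) {x : Fin n → ℤ} (h : ∀ u, x u ≤ 1) (u : Fin n) :
    balance M c x u ≤ 1 := by
  rw [balance_apply]
  have h1 := h u
  have h2 := h (partner M u)
  split_ifs <;> omega

theorem balance_add_partner (c : Coins n) (x : Fin n → ℤ) {u : Fin n} (h : partner M u ≠ u) :
    balance M c x u + balance M c x (partner M u) = x u + x (partner M u) := by
  rw [balance_apply, balance_apply, partner_partner, getsExcess_swap c (Ne.symm h),
    add_comm (x (partner M u)) (x u)]
  by_cases h1 : GetsExcess c u (partner M u)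
  · simp only [h1, if_true, not_true_eq_false, if_false]; omega
  · simp only [h1, if_true, not_false_eq_true, if_false]; omega

theorem sum_balance (c : Coins n) (x : Fin n → ℤ) : ∑ u, balance M c x u = ∑ u, x u := by
  have h1 : ∑ u, balance M c x (partner M u) = ∑ u, balance M c x u :=
    Equiv.sum_comp (partnerEquiv M) _
  have h2 : ∑ u, x (partner M u) = ∑ u, x u := Equiv.sum_comp (partnerEquiv M) _
  have h3 : ∑ u, (balance M c x u + balance M c x (partner M u))
      = ∑ u, (x u + x (partner M u)) := by
    refine Finset.sum_congr rfl fun u _ => ?_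
    by_cases h : partner M u = u
    · have : balance M c x u = x u := by unfold balance; rw [if_pos h]
      rw [h, this]
    · exact balance_add_partner M c x h
  rw [Finset.sum_add_distrib, Finset.sum_add_distrib, h1, h2] at h3
  linarith

end Balance

/-! ### Expected collisions do not exceed those of independent walkers -/

section CollisionBound

variable {n : ℕ} {G : SimpleGraph (Fin n)} (M : Matching G)

/-- Coins of different pairs are uncorrelated, so the only covariance is between a node and itself
(sign `+`) and between a node and its partner (sign `-`). -/
theorem coinAvg_affine_mul (A α X β : Fin n → ℝ) (hα : ∀ u, partner M u = u → α u = 0)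
    (hβ : ∀ u, β (partner M u) = β u) (u v : Fin n) :
    coinAvg (fun c => (A u + coinSign c u (partner M u) * α u) *
        (X v + coinSign c v (partner M v) * β v)) =
      A u * X v + α u * β u * ((if v = u then 1 else 0) - (if v = partner M u then 1 else 0)) := by
  have h1 : (fun c : Coins n => (A u + coinSign c u (partner M u) * α u) *
        (X v + coinSign c v (partner M v) * β v)) = fun c =>
      (A u * X v + (A u * β v) * coinSign c v (partner M v)) + ((X v * α u) *
        coinSign c u (partner M u) +
        (α u * β v) * (coinSign c u (partner M u) * coinSign c v (partner M v))) := by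
    funext c; ring
  rw [h1, coinAvg_add, coinAvg_add, coinAvg_add, coinAvg_const, coinAvg_const_mul,
    coinAvg_const_mul, coinAvg_const_mul, coinAvg_coinSign, coinAvg_coinSign]
  by_cases hu : partner M u = u
  · rw [hα u hu]; ring
  by_cases h2 : v = u
  · subst h2
    simp only [coinSign_mul_self, coinAvg_const, if_true, Ne.symm hu, if_false]
    ring
  by_cases h3 : v = partner M u
  · subst h3
    have : (fun c : Coins n => coinSign c u (partner M u) *
        coinSign c (partner M u) (partner M (partner M u))) = fun _ => (-1 : ℝ) := by
      funext c
      rw [partner_partner, coinSign_swap c (Ne.symm hu), mul_neg, coinSign_mul_self]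
    rw [this, coinAvg_const, hβ]
    simp only [if_true, hu, if_false]
    ring
  · rw [coinAvg_coinSign_mul]
    · simp [h2, h3]
    · intro h
      rcases Sym2.eq_iff.1 h with ⟨h4, -⟩ | ⟨h4, -⟩
      · exact h2 h4
      · exact h3 h4

theorem sum_average_mul (f g : Fin n → ℝ) :
    ∑ u, (f u + f (partner M u)) / 2 * g u = ∑ u, f u * ((g u + g (partner M u)) / 2) := by
  have h := sum_partner M (fun u => f (partner M u) * g u)
  simp only [partner_partner] at h
  have h1 : ∀ u, (f u + f (partner M u)) / 2 * g u = f u * g u / 2 + f (partner M u) * g u / 2 :=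
    fun u => by ring
  have h2 : ∀ u, f u * ((g u + g (partner M u)) / 2) =
      f u * g u / 2 + f u * g (partner M u) / 2 := fun u => by ring
  simp only [h1, h2, Finset.sum_add_distrib, ← Finset.sum_div]
  rw [h]

/-- Since `partner` is an involution, it suffices to compare sums over matched pairs; the nodewise
comparison may fail. -/
theorem sum_le_sum_of_add_partner {f g : Fin n → ℝ}
    (h : ∀ u, f u + f (partner M u) ≤ g u + g (partner M u)) : ∑ u, f u ≤ ∑ u, g u := by
  have h1 := Finset.sum_le_sum fun u (_ : u ∈ Finset.univ) => h u
  rw [Finset.sum_add_distrib, Finset.sum_add_distrib, sum_partner M f, sum_partner M g] at h1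
  linarith

/-- The expected number of pairs of a marked token and another token that would end at the same
node if pairs at nodes `u`, `v` did so with probability `h u v`; here `x` counts all tokens and
`b` the unmarked ones. -/
noncomputable def collisionBound (h : Matrix (Fin n) (Fin n) ℝ) (x b : Fin n → ℤ) : ℝ :=
  ∑ u, ∑ v, ((x u : ℝ) - b u) * x v * h u v - ∑ u, ((x u : ℝ) - b u) * h u u

/-- One round does not increase the expected collision bound (the kernel being averaged). -/
theorem coinAvg_collisionBound_le {h : Matrix (Fin n) (Fin n) ℝ} (hsymm : ∀ u v, h u v = h v u)
    (hpos : ∀ u v, 2 * h u v ≤ h u u + h v v) {x b : Fin n → ℤ} (hb : ∀ u, 0 ≤ b u)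
    (hbx : ∀ u, b u ≤ x u) :
    coinAvg (fun c => collisionBound h (balance M c x) (balance M c b)) ≤
      collisionBound (matchingMatrix M * h * matchingMatrix M) x b := by
  set ox : Fin n → ℝ := fun u => (((x u + x (partner M u)) % 2 : ℤ) : ℝ) with hox
  set ob : Fin n → ℝ := fun u => (((b u + b (partner M u)) % 2 : ℤ) : ℝ) with hob
  set a : Fin n → ℝ := fun u => (x u : ℝ) - b u with ha
  set A : Fin n → ℝ := fun u => (a u + a (partner M u)) / 2 with hA
  set X : Fin n → ℝ := fun u => ((x u : ℝ) + x (partner M u)) / 2 with hX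
  set α : Fin n → ℝ := fun u => (ox u - ob u) / 2 with hα
  set β : Fin n → ℝ := fun u => ox u / 2 with hβ
  have hoxp : ∀ u, ox (partner M u) = ox u := fun u => by
    simp only [hox, partner_partner]; rw [add_comm]
  have hobp : ∀ u, ob (partner M u) = ob u := fun u => by
    simp only [hob, partner_partner]; rw [add_comm]
  have hox0 : ∀ u, partner M u = u → ox u = 0 := fun u hu => by
    simp only [hox, hu]
    rw [show (x u + x u) % 2 = 0 by omega]; simp
  have hob0 : ∀ u, partner M u = u → ob u = 0 := fun u hu => by
    simp only [hob, hu]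
    rw [show (b u + b u) % 2 = 0 by omega]; simp
  have hα0 : ∀ u, partner M u = u → α u = 0 := fun u hu => by
    simp only [hα, hox0 u hu, hob0 u hu]; norm_num
  have hβp : ∀ u, β (partner M u) = β u := fun u => by simp only [hβ, hoxp]
  have hbal : ∀ c u, (balance M c x u : ℝ) = X u + coinSign c u (partner M u) * β u := fun c u => by
    rw [balance_eq_average]; simp only [hX, hβ, hox]; ring
  have hbala : ∀ c u, (balance M c x u : ℝ) - balance M c b u =
      A u + coinSign c u (partner M u) * α u := fun c u => by
    rw [balance_eq_average, balance_eq_average]; simp only [hA, hα, ha, hox, hob]; ring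
  -- The product of the means survives, together with the covariances at `v = u` and at `v = partner
  -- M u`.
  have hE : coinAvg (fun c => collisionBound h (balance M c x) (balance M c b)) =
      ∑ u, ∑ v, A u * X v * h u v + ∑ u, (α u * β u * (h u u - h u (partner M u)) - A u * h u u) := by
    have e1 : (fun c => collisionBound h (balance M c x) (balance M c b)) = fun c =>
        ∑ u, ∑ v, h u v * ((A u + coinSign c u (partner M u) * α u) *
        (X v + coinSign c v (partner M v) * β v)) + ∑ u, (-(A u * h u u) +
          (-(α u * h u u)) * coinSign c u (partner M u)) := by
      funext c
      simp only [collisionBound, hbala]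
      simp only [hbal]
      rw [sub_eq_add_neg, ← Finset.sum_neg_distrib]
      congr 1
      · exact Finset.sum_congr rfl fun u _ => Finset.sum_congr rfl fun v _ => by ring
      · exact Finset.sum_congr rfl fun u _ => by ring
    rw [e1, coinAvg_add, coinAvg_sum, coinAvg_sum, ← Finset.sum_add_distrib,
      ← Finset.sum_add_distrib]
    refine Finset.sum_congr rfl fun u _ => ?_
    rw [coinAvg_sum, coinAvg_add, coinAvg_const, coinAvg_const_mul, coinAvg_coinSign]
    simp only [coinAvg_const_mul, coinAvg_affine_mul M A α X β hα0 hβp]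
    have e2 : ∀ v, h u v * (A u * X v + α u * β u *
        ((if v = u then 1 else 0) - (if v = partner M u then 1 else 0))) =
        A u * X v * h u v + ((if v = u then α u * β u * h u v else 0) -
          (if v = partner M u then α u * β u * h u v else 0)) := by
      intro v
      split_ifs <;> ring
    rw [Finset.sum_congr rfl fun v _ => e2 v, Finset.sum_add_distrib, Finset.sum_sub_distrib]
    simp
    ring
  have hF : collisionBound (matchingMatrix M * h * matchingMatrix M) x b =
      ∑ u, ∑ v, A u * X v * h u v -
        ∑ u, a u * ((h u u + 2 * h u (partner M u) + h (partner M u) (partner M u)) / 4) := by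
    unfold collisionBound
    congr 1
    · have e1 : ∀ u, ∑ v, A u * X v * h u v =
          A u * ∑ v, (x v : ℝ) * ((h u v + h u (partner M v)) / 2) := by
        intro u
        rw [← sum_average_mul M (fun v => (x v : ℝ)) (fun v => h u v), Finset.mul_sum]
        exact Finset.sum_congr rfl fun v _ => by simp only [hX]; ring
      rw [Finset.sum_congr rfl fun u _ => e1 u]
      simp only [hA]
      rw [sum_average_mul M a]
      refine Finset.sum_congr rfl fun u _ => ?_
      rw [← Finset.sum_add_distrib, Finset.sum_div, Finset.mul_sum]
      refine Finset.sum_congr rfl fun v _ => ?_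
      rw [matchingMatrix_conj_apply]
      simp only [ha]; ring
    · refine Finset.sum_congr rfl fun u _ => ?_
      rw [matchingMatrix_conj_apply, hsymm (partner M u) u]
      simp only [ha]; ring
  rw [hE, hF, sub_eq_add_neg, ← Finset.sum_neg_distrib]
  -- With the main terms equal, the claim for a pair `u, v` becomes `α β N ≤ (A / 2) N`, where `N =
  -- h u u + h v v - 2 h u v` is non-negative.
  refine add_le_add le_rfl (sum_le_sum_of_add_partner M fun u => ?_)
  have hN := hpos u (partner M u)
  have hαβ : α u * β u ≤ A u / 2 := by
    simp only [hα, hβ, hA, ha, hox, hob]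
    have hbu := hb u
    have hbu' := hb (partner M u)
    have hxu := hbx u
    have hxu' := hbx (partner M u)
    generalize x u = x₁ at *
    generalize x (partner M u) = x₂ at *
    generalize b u = b₁ at *
    generalize b (partner M u) = b₂ at *
    -- The left side is positive only if the pair has odd total load and even unmarked load; then it
    -- carries an odd number of marked tokens, hence at least one.
    have hi : ((x₁ + x₂) % 2 - (b₁ + b₂) % 2) * ((x₁ + x₂) % 2) ≤ (x₁ - b₁) + (x₂ - b₂) := by
      rcases Int.emod_two_eq_zero_or_one (x₁ + x₂) with h1 | h1 <;>
      rcases Int.emod_two_eq_zero_or_one (b₁ + b₂) with h2 | h2 <;> rw [h1, h2] <;> omega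
    have hr : ((((x₁ + x₂) % 2 : ℤ) : ℝ) - (((b₁ + b₂) % 2 : ℤ) : ℝ)) * (((x₁ + x₂) % 2 : ℤ) : ℝ)
        ≤ ((x₁ : ℝ) - b₁) + (x₂ - b₂) := by exact_mod_cast hi
    linarith
  have hαp : α (partner M u) = α u := by simp only [hα, hoxp, hobp]
  have hAp : A (partner M u) = A u := by simp only [hA, partner_partner]; ring
  have haA : a (partner M u) = 2 * A u - a u := by simp only [hA]; ring
  simp only [partner_partner]
  rw [hαp, hβp, hAp, haA, hsymm (partner M u) u]
  nlinarith [mul_le_mul_of_nonneg_right hαβ (sub_nonneg.2 hN)]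

end CollisionBound

/-! ### Negative dependence through product moments -/

section ProductMoment

variable {n : ℕ} {G : SimpleGraph (Fin n)} (M : Matching G)

theorem coinAvg_prod (F : Sym2 (Fin n) → Bool → ℝ) :
    coinAvg (fun c => ∏ e, F e (c e)) = ∏ e, (F e true + F e false) / 2 := by
  have h1 : ∑ c : Coins n, ∏ e, F e (c e) = ∏ e, (F e true + F e false) := by
    have := Finset.prod_univ_sum (fun _ : Sym2 (Fin n) => (Finset.univ : Finset Bool)) F
    rw [Fintype.piFinset_univ] at this
    rw [← this]
    exact Finset.prod_congr rfl fun e _ => by simp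
  rw [coinAvg, h1, Finset.prod_div_distrib]
  congr 1
  simp

theorem balance_eq_const_coins (c : Coins n) (x : Fin n → ℤ) (u : Fin n) :
    balance M c x u = balance M (fun _ => c s(u, partner M u)) x u := by
  rw [balance_apply, balance_apply]
  rfl

/-- Factor out equal powers of `p` and `q` and use `p q ≤ ((p + q) / 2) ^ 2`; an odd token leaves
the exact factor `(p + q) / 2`. -/
theorem pow_mul_pow_add_le {p q : ℝ} (hp : 0 < p) (hq : 0 < q) (k l : ℕ) :
    (p ^ ((k + l + 1) / 2) * q ^ ((k + l) / 2) + p ^ ((k + l) / 2) * q ^ ((k + l + 1) / 2)) / 2 ≤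
      ((p + q) / 2) ^ k * ((p + q) / 2) ^ l := by
  rw [← pow_add]
  have hpq : p * q ≤ ((p + q) / 2) ^ 2 := by nlinarith [sq_nonneg (p - q)]
  have hpq0 : 0 ≤ p * q := by positivity
  rcases Nat.even_or_odd' (k + l) with ⟨j, hj | hj⟩
  · rw [hj, show (2 * j + 1) / 2 = j by omega, show 2 * j / 2 = j by omega, ← mul_pow, pow_mul,
      add_self_div_two]
    exact pow_le_pow_left₀ hpq0 hpq j
  · rw [hj, show (2 * j + 1 + 1) / 2 = j + 1 by omega, show (2 * j + 1) / 2 = j by omega]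
    have : (p ^ (j + 1) * q ^ j + p ^ j * q ^ (j + 1)) / 2 = (p * q) ^ j * ((p + q) / 2) := by
      rw [mul_pow]; ring
    rw [this, pow_succ, pow_mul]
    exact mul_le_mul_of_nonneg_right (pow_le_pow_left₀ hpq0 hpq j) (by positivity)

/-- The number of tokens is negatively correlated: product moments are at most those of
independent tokens. -/
theorem coinAvg_prod_pow_le {g : Fin n → ℝ} (hg : ∀ u, 0 < g u) {x : Fin n → ℤ}
    (hx : ∀ u, 0 ≤ x u) :
    coinAvg (fun c => ∏ u, g u ^ (balance M c x u).toNat) ≤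
      ∏ u, ((g u + g (partner M u)) / 2) ^ (x u).toNat := by
  classical
  -- Nodes are grouped by the coin they read, so that independence of the coins turns the average
  -- into a product over coins. A coin is read by a matched pair, by one unmatched node, or by
  -- nobody.
  set F : Sym2 (Fin n) → Bool → ℝ := fun e b =>
    ∏ u with s(u, partner M u) = e, g u ^ (balance M (fun _ => b) x u).toNat with hF
  have h1 : (fun c : Coins n => ∏ u, g u ^ (balance M c x u).toNat) = fun c => ∏ e, F e (c e) := by
    funext c
    rw [← Finset.prod_fiberwise Finset.univ (fun u => s(u, partner M u))]
    refine Finset.prod_congr rfl fun e _ => ?_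
    refine Finset.prod_congr rfl fun u hu => ?_
    rw [balance_eq_const_coins, (Finset.mem_filter.1 hu).2]
  rw [h1, coinAvg_prod,
    ← Finset.prod_fiberwise Finset.univ (fun u => s(u, partner M u))]
  have hFpos : ∀ e b, 0 < F e b := fun e b => Finset.prod_pos fun u _ => pow_pos (hg u) _
  refine Finset.prod_le_prod (fun e _ => by have := hFpos e true; have := hFpos e false; positivity)
    fun e _ => ?_
  by_cases he : ∃ u, s(u, partner M u) = e
  · obtain ⟨u, rfl⟩ := he
    have hfil : (Finset.univ.filter fun v => s(v, partner M v) = s(u, partner M u)) =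
        {u, partner M u} := by
      ext v
      simp only [Finset.mem_filter, Finset.mem_univ, true_and, Finset.mem_insert,
        Finset.mem_singleton, Sym2.eq_iff]
      constructor
      · rintro (⟨h, -⟩ | ⟨h, -⟩)
        · exact Or.inl h
        · exact Or.inr h
      · rintro (rfl | rfl)
        · exact Or.inl ⟨rfl, rfl⟩
        · exact Or.inr ⟨rfl, partner_partner M u⟩
    simp only [hF, hfil]
    by_cases hu : partner M u = u
    · have : ∀ b : Bool, balance M (fun _ => b) x u = x u := fun b => by
        unfold balance; rw [if_pos hu]
      simp [hu, this]
    · rw [Finset.prod_pair (Ne.symm hu), Finset.prod_pair (Ne.symm hu),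
        Finset.prod_pair (Ne.symm hu), partner_partner, add_comm (g (partner M u)) (g u)]
      have hX := hx u
      have hX' := hx (partner M u)
      have key := pow_mul_pow_add_le (hg u) (hg (partner M u)) (x u).toNat (x (partner M u)).toNat
      have t1 : ((x u + x (partner M u) + 1) / 2).toNat =
        ((x u).toNat + (x (partner M u)).toNat + 1) / 2 := by omega
      have t2 : ((x u + x (partner M u)) / 2).toNat =
        ((x u).toNat + (x (partner M u)).toNat) / 2 := by omega
      have bal : ∀ b : Bool, ∀ v, balance M (fun _ => b) x v = if GetsExcess (fun _ => b) v
          (partner M v) then (x v + x (partner M v) + 1) / 2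
          else (x v + x (partner M v)) / 2 := fun b v => by
        rw [balance_apply]
      simp only [bal, partner_partner, getsExcess_swap _ (Ne.symm hu),
        add_comm (x (partner M u)) (x u)]
      unfold GetsExcess
      by_cases hlt : u < partner M u
      · simpa [hlt, t1, t2] using key
      · simpa [hlt, t1, t2, add_comm] using key
  · have hfil : (Finset.univ.filter fun v => s(v, partner M v) = e) = ∅ := by
      ext v
      simp only [Finset.mem_filter, Finset.mem_univ, true_and, Finset.notMem_empty, iff_false]
      exact fun h => he ⟨v, h⟩
    simp [hF, hfil]

end ProductMoment

/-! ### Expectations under laws on finite and countable types -/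

section Average

variable {α : Type*} [Fintype α]

/-- The expectation under a law on a finite type. -/
noncomputable def pmfAvg (q : PMF α) (f : α → ℝ) : ℝ := ∑ a, (q a).toReal * f a

theorem sum_toReal_pmf (q : PMF α) : ∑ a, (q a).toReal = 1 := by
  rw [← ENNReal.toReal_sum fun a _ => q.apply_ne_top a, ← tsum_fintype (L := .unconditional α),
    q.tsum_coe, ENNReal.toReal_one]

theorem pmfAvg_mono (q : PMF α) {f g : α → ℝ} (h : ∀ a, f a ≤ g a) : pmfAvg q f ≤ pmfAvg q g :=
  Finset.sum_le_sum fun a _ => mul_le_mul_of_nonneg_left (h a) ENNReal.toReal_nonneg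

@[simp] theorem pmfAvg_const (q : PMF α) (a : ℝ) : pmfAvg q (fun _ => a) = a := by
  rw [pmfAvg, ← Finset.sum_mul, sum_toReal_pmf, one_mul]

theorem pmfAvg_add (q : PMF α) (f g : α → ℝ) :
    pmfAvg q (fun a => f a + g a) = pmfAvg q f + pmfAvg q g := by
  simp only [pmfAvg, mul_add, Finset.sum_add_distrib]

theorem pmfAvg_const_mul (q : PMF α) (r : ℝ) (f : α → ℝ) :
    pmfAvg q (fun a => r * f a) = r * pmfAvg q f := by
  simp only [pmfAvg, Finset.mul_sum]
  exact Finset.sum_congr rfl fun a _ => by ring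

theorem pmfAvg_sum {ι : Type*} (q : PMF α) (s : Finset ι) (f : ι → α → ℝ) :
    pmfAvg q (fun a => ∑ i ∈ s, f i a) = ∑ i ∈ s, pmfAvg q (f i) := by
  simp only [pmfAvg, Finset.mul_sum]
  exact Finset.sum_comm

theorem pmfAvg_pure (a : α) (f : α → ℝ) : pmfAvg (PMF.pure a) f = f a := by
  classical
  simp only [pmfAvg, PMF.pure_apply]
  rw [Finset.sum_eq_single a (fun b _ hb => by simp [hb]) (by simp)]
  simp

theorem tsum_mul_ofReal (q : PMF α) {f : α → ℝ} (hf : ∀ a, 0 ≤ f a) :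
    ∑' a, q a * ENNReal.ofReal (f a) = ENNReal.ofReal (pmfAvg q f) := by
  rw [tsum_fintype, pmfAvg,
    ENNReal.ofReal_sum_of_nonneg fun a _ => mul_nonneg ENNReal.toReal_nonneg (hf a)]
  refine Finset.sum_congr rfl fun a _ => ?_
  rw [ENNReal.ofReal_mul ENNReal.toReal_nonneg, ENNReal.ofReal_toReal (q.apply_ne_top a)]

end Average

theorem tsum_bind_mul {α β : Type*} (p : PMF α) (k : α → PMF β) (g : β → ENNReal) :
    ∑' x, (p.bind k) x * g x = ∑' y, p y * ∑' x, k y x * g x := by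
  simp only [PMF.bind_apply, ← ENNReal.tsum_mul_right, ← ENNReal.tsum_mul_left]
  rw [ENNReal.tsum_comm]
  exact tsum_congr fun y => tsum_congr fun x => mul_assoc _ _ _

theorem tsum_pure_mul {α : Type*} (a : α) (g : α → ENNReal) :
    ∑' x, (PMF.pure a) x * g x = g a := by
  classical
  rw [tsum_eq_single a]
  · simp
  · intro b hb; simp [hb]

theorem tsum_map_mul {α β : Type*} (p : PMF α) (k : α → β) (g : β → ENNReal) :
    ∑' x, (p.map k) x * g x = ∑' y, p y * g (k y) := by
  rw [PMF.map, tsum_bind_mul]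
  exact tsum_congr fun y => by rw [Function.comp_apply, tsum_pure_mul]

/-! ### The load process as a composition of expectation operators -/

section Operators

variable {n : ℕ} {G : SimpleGraph (Fin n)}

noncomputable instance : Fintype (Matching G) := Fintype.ofFinite _

theorem pmfAvg_coins (f : Coins n → ℝ) :
    pmfAvg (PMF.uniformOfFintype (Coins n)) f = coinAvg f := by
  simp only [pmfAvg, PMF.uniformOfFintype_apply, ← Finset.mul_sum, coinAvg]
  rw [ENNReal.toReal_inv, ENNReal.toReal_natCast, div_eq_inv_mul]

variable (μ : ℕ → PMF (Matching G))

/-- The expectation of `f` after round `t + 1` as a function of the load before it. -/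
noncomputable def stepAvg (t : ℕ) (f : (Fin n → ℤ) → ℝ) (x : Fin n → ℤ) : ℝ :=
  pmfAvg (μ t) fun M => coinAvg fun c => f (balance M c x)

/-- The expectation of `f` after the rounds `r + 1, …, r + L` as a function of the load before. -/
noncomputable def expLoad (r : ℕ) : ℕ → ((Fin n → ℤ) → ℝ) → (Fin n → ℤ) → ℝ
  | 0, f => f
  | L + 1, f => expLoad r L (stepAvg μ (r + L) f)

theorem expLoad_comp (r a b : ℕ) (f : (Fin n → ℤ) → ℝ) :
    expLoad μ r (a + b) f = expLoad μ r a (expLoad μ (r + a) b f) := by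
  induction b generalizing f with
  | zero => rfl
  | succ b ih =>
    rw [← add_assoc, expLoad, ih, expLoad, add_assoc]

theorem expLoad_add (r L : ℕ) (f g : (Fin n → ℤ) → ℝ) :
    expLoad μ r L (fun x => f x + g x) = fun x => expLoad μ r L f x + expLoad μ r L g x := by
  induction L generalizing f g with
  | zero => rfl
  | succ L ih =>
    simp only [expLoad]
    rw [← ih]
    congr 1
    funext x
    simp only [stepAvg, coinAvg_add, pmfAvg_add]

theorem expLoad_const_mul (r L : ℕ) (a : ℝ) (f : (Fin n → ℤ) → ℝ) :
    expLoad μ r L (fun x => a * f x) = fun x => a * expLoad μ r L f x := by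
  induction L generalizing f with
  | zero => rfl
  | succ L ih =>
    simp only [expLoad]
    rw [← ih]
    congr 1
    funext x
    simp only [stepAvg, coinAvg_const_mul, pmfAvg_const_mul]

theorem expLoad_const (r L : ℕ) (a : ℝ) :
    expLoad μ r L (fun _ => a) = fun _ => a := by
  induction L with
  | zero => rfl
  | succ L ih =>
    rw [expLoad]
    convert ih using 2
    funext x
    simp only [stepAvg, coinAvg_const, pmfAvg_const]

theorem expLoad_sum {ι : Type*} (s : Finset ι) (r L : ℕ) (f : ι → (Fin n → ℤ) → ℝ) :
    expLoad μ r L (fun x => ∑ i ∈ s, f i x) = fun x => ∑ i ∈ s, expLoad μ r L (f i) x := by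
  induction L generalizing f with
  | zero => rfl
  | succ L ih =>
    simp only [expLoad]
    rw [← ih]
    congr 1
    funext x
    simp only [stepAvg, coinAvg_sum, pmfAvg_sum]

/-- Non-negative loads with `m` tokens. -/
def IsLoad (m : ℤ) (x : Fin n → ℤ) : Prop := (∀ u, 0 ≤ x u) ∧ ∑ u, x u = m

theorem IsLoad.balance {m : ℤ} {x : Fin n → ℤ} (hx : IsLoad m x) (M : Matching G) (c : Coins n) :
    IsLoad m (balance M c x) :=
  ⟨balance_nonneg M c hx.1, by rw [sum_balance]; exact hx.2⟩

theorem expLoad_mono {m : ℤ} (r L : ℕ) {f g : (Fin n → ℤ) → ℝ}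
    (h : ∀ x, IsLoad m x → f x ≤ g x) (x : Fin n → ℤ) (hx : IsLoad m x) :
    expLoad μ r L f x ≤ expLoad μ r L g x := by
  induction L generalizing f g with
  | zero => exact h x hx
  | succ L ih =>
    exact ih fun y hy => pmfAvg_mono _ fun M => coinAvg_mono fun c => h _ (hy.balance M c)

theorem stepAvg_nonneg (t : ℕ) {f : (Fin n → ℤ) → ℝ} (hf : ∀ x, 0 ≤ f x) (x : Fin n → ℤ) :
    0 ≤ stepAvg μ t f x :=
  (pmfAvg_const (μ t) 0).ge.trans (pmfAvg_mono _ fun _ =>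
    (coinAvg_const (n := n) 0).ge.trans (coinAvg_mono fun _ => hf _))

theorem expLoad_nonneg (r L : ℕ) {f : (Fin n → ℤ) → ℝ} (hf : ∀ x, 0 ≤ f x) (x : Fin n → ℤ) :
    0 ≤ expLoad μ r L f x := by
  induction L generalizing f with
  | zero => exact hf x
  | succ L ih => exact ih (stepAvg_nonneg μ _ hf)

/-- Load vectors form an infinite type, but each round averages over finitely many matchings and
coins. Working in `ENNReal` with non-negative `f` avoids summability questions. -/
theorem tsum_loadLaw_mul (x₀ : Fin n → ℤ) (t : ℕ) {f : (Fin n → ℤ) → ℝ} (hf : ∀ x, 0 ≤ f x) :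
    ∑' x, loadLaw μ x₀ t x * ENNReal.ofReal (f x) = ENNReal.ofReal (expLoad μ 0 t f x₀) := by
  induction t generalizing f with
  | zero => rw [loadLaw, tsum_pure_mul]; rfl
  | succ t ih =>
    have hc : ∀ (M : Matching G) (x : Fin n → ℤ), 0 ≤ coinAvg fun c => f (balance M c x) :=
      fun M x => (coinAvg_const (n := n) 0).ge.trans (coinAvg_mono fun c => hf _)
    rw [loadLaw, tsum_bind_mul, expLoad, zero_add, ← ih (stepAvg_nonneg μ t hf)]
    refine tsum_congr fun x => ?_
    rw [tsum_bind_mul, stepAvg, ← tsum_mul_ofReal _ fun M => hc M x]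
    congr 1
    refine tsum_congr fun M => ?_
    rw [tsum_map_mul, tsum_mul_ofReal _ fun c => hf _, pmfAvg_coins]

open Classical in
theorem prob_loadLaw (x₀ : Fin n → ℤ) (t : ℕ) (S : Set (Fin n → ℤ)) :
    prob (loadLaw μ x₀ t) S = expLoad μ 0 t (fun x => if x ∈ S then 1 else 0) x₀ := by
  have h := tsum_loadLaw_mul μ x₀ t (f := fun x => if x ∈ S then 1 else 0)
    fun x => by positivity
  have h0 := expLoad_nonneg μ 0 t (f := fun x => if x ∈ S then 1 else 0)
    (fun x => by positivity) x₀
  rw [prob, PMF.toOuterMeasure_apply, ← ENNReal.toReal_ofReal h0, ← h]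
  congr 1
  refine tsum_congr fun x => ?_
  by_cases hx : x ∈ S <;> simp [hx]

end Operators

/-! ### Averaged kernels and their contraction on sum-zero vectors -/

section Kernels

variable {n : ℕ} {G : SimpleGraph (Fin n)}

/-- The quadratic form of a kernel. -/
def quadForm (h : Matrix (Fin n) (Fin n) ℝ) (y : Fin n → ℝ) : ℝ := ∑ u, ∑ v, y u * y v * h u v

/-- Symmetric positive semidefinite kernels that are stochastic matrices. -/
structure IsAveragingKernel (h : Matrix (Fin n) (Fin n) ℝ) : Prop where
  symm : ∀ u v, h u v = h v u
  nonneg : ∀ u v, 0 ≤ h u v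
  sum_row : ∀ u, ∑ v, h u v = 1
  quadForm_nonneg : ∀ y, 0 ≤ quadForm h y

theorem quadForm_conj (M : Matching G) (h : Matrix (Fin n) (Fin n) ℝ) (y : Fin n → ℝ) :
    quadForm (matchingMatrix M * h * matchingMatrix M) y =
      quadForm h ((matchingMatrix M).mulVec y) := by
  unfold quadForm
  have e1 : ∀ u, ∑ v, (matchingMatrix M).mulVec y u * (matchingMatrix M).mulVec y v * h u v =
      (y u + y (partner M u)) / 2 * ∑ v, y v * ((h u v + h u (partner M v)) / 2) := by
    intro u
    rw [← sum_average_mul M y (fun v => h u v), Finset.mul_sum]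
    exact Finset.sum_congr rfl fun v _ => by
      rw [matchingMatrix_mulVec, matchingMatrix_mulVec]; ring
  rw [Finset.sum_congr rfl fun u _ => e1 u, sum_average_mul M y]
  refine Finset.sum_congr rfl fun u _ => ?_
  rw [← Finset.sum_add_distrib, Finset.sum_div, Finset.mul_sum]
  refine Finset.sum_congr rfl fun v _ => ?_
  rw [matchingMatrix_conj_apply]
  ring

theorem quadForm_one (y : Fin n → ℝ) : quadForm 1 y = ∑ u, y u ^ 2 := by
  unfold quadForm
  refine Finset.sum_congr rfl fun u _ => ?_
  simp [Matrix.one_apply, sq]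

theorem isAveragingKernel_one : IsAveragingKernel (1 : Matrix (Fin n) (Fin n) ℝ) where
  symm u v := by simp [Matrix.one_apply, eq_comm]
  nonneg u v := by rw [Matrix.one_apply]; positivity
  sum_row u := by simp [Matrix.one_apply]
  quadForm_nonneg y := by rw [quadForm_one]; positivity

/-- Test positive semidefiniteness on the difference of two unit vectors. -/
theorem IsAveragingKernel.two_mul_le {h : Matrix (Fin n) (Fin n) ℝ} (H : IsAveragingKernel h)
    (u v : Fin n) : 2 * h u v ≤ h u u + h v v := by
  have := H.quadForm_nonneg (fun w => (if w = u then 1 else 0) - (if w = v then 1 else 0))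
  have e : quadForm h (fun w => (if w = u then 1 else 0) - (if w = v then 1 else 0)) =
      h u u - h v u - (h u v - h v v) := by
    simp [quadForm, sub_mul, mul_sub, Finset.sum_sub_distrib]
  rw [e, H.symm v u] at this
  linarith

theorem sum_sq_mulVec_le (M : Matching G) (y : Fin n → ℝ) :
    ∑ u, (matchingMatrix M).mulVec y u ^ 2 ≤ ∑ u, y u ^ 2 := by
  refine sum_le_sum_of_add_partner M fun u => ?_
  rw [matchingMatrix_mulVec, matchingMatrix_mulVec, partner_partner]
  nlinarith [sq_nonneg (y u - y (partner M u))]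

theorem sum_mulVec (M : Matching G) (y : Fin n → ℝ) :
    ∑ u, (matchingMatrix M).mulVec y u = ∑ u, y u := by
  simp only [matchingMatrix_mulVec, ← Finset.sum_div, Finset.sum_add_distrib, sum_partner]
  ring

variable (μ : ℕ → PMF (Matching G))

/-- The kernel averaged over the matching of one round. -/
noncomputable def kernelStep (t : ℕ) (h : Matrix (Fin n) (Fin n) ℝ) : Matrix (Fin n) (Fin n) ℝ :=
  Matrix.of fun u v => pmfAvg (μ t) fun M => (matchingMatrix M * h * matchingMatrix M) u v

theorem quadForm_kernelStep (t : ℕ) (h : Matrix (Fin n) (Fin n) ℝ) (y : Fin n → ℝ) :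
    quadForm (kernelStep μ t h) y =
      pmfAvg (μ t) fun M => quadForm h ((matchingMatrix M).mulVec y) := by
  rw [funext fun M => (quadForm_conj M h y).symm]
  simp only [quadForm, kernelStep, Matrix.of_apply, pmfAvg_sum, pmfAvg_const_mul]

theorem IsAveragingKernel.kernelStep {h : Matrix (Fin n) (Fin n) ℝ} (H : IsAveragingKernel h)
    (t : ℕ) : IsAveragingKernel (kernelStep μ t h) where
  symm u v := by
    simp only [MatchingModel.kernelStep, Matrix.of_apply]
    congr 1
    funext M
    rw [matchingMatrix_conj_apply, matchingMatrix_conj_apply, H.symm v u, H.symm v, H.symm _ u,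
      H.symm _ (partner M u)]
    ring
  nonneg u v := by
    refine (pmfAvg_const (μ t) 0).ge.trans (pmfAvg_mono _ fun M => ?_)
    rw [matchingMatrix_conj_apply]
    have := H.nonneg
    exact div_nonneg (add_nonneg (add_nonneg (add_nonneg (this _ _) (this _ _)) (this _ _))
      (this _ _)) (by norm_num)
  sum_row u := by
    simp only [MatchingModel.kernelStep, Matrix.of_apply]
    rw [← pmfAvg_sum]
    convert pmfAvg_const (μ t) 1 using 2
    funext M
    simp only [matchingMatrix_conj_apply, ← Finset.sum_div, Finset.sum_add_distrib, H.sum_row,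
      sum_partner M (fun v => h u v), sum_partner M (fun v => h (partner M u) v)]
    norm_num
  quadForm_nonneg y := by
    rw [quadForm_kernelStep]
    exact (pmfAvg_const (μ t) 0).ge.trans (pmfAvg_mono _ fun M => H.quadForm_nonneg _)

/-- The kernel averaged over the matchings of the rounds `r + 1, …, r + L`, last round first. -/
noncomputable def kernelBack (r : ℕ) : ℕ → Matrix (Fin n) (Fin n) ℝ → Matrix (Fin n) (Fin n) ℝ
  | 0, h => h
  | L + 1, h => kernelBack r L (kernelStep μ (r + L) h)

/-- The identity kernel averaged over the matchings of the rounds `1, …, t`, first round first. -/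
noncomputable def kernelForth : ℕ → Matrix (Fin n) (Fin n) ℝ
  | 0 => 1
  | t + 1 => kernelStep μ t (kernelForth t)

theorem IsAveragingKernel.kernelBack {h : Matrix (Fin n) (Fin n) ℝ} (H : IsAveragingKernel h)
    (r L : ℕ) : IsAveragingKernel (kernelBack μ r L h) := by
  induction L generalizing h with
  | zero => exact H
  | succ L ih => exact ih (H.kernelStep μ _)

theorem kernelBack_comp (r a b : ℕ) (h : Matrix (Fin n) (Fin n) ℝ) :
    kernelBack μ r (a + b) h = kernelBack μ r a (kernelBack μ (r + a) b h) := by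
  induction b generalizing h with
  | zero => rfl
  | succ b ih => rw [← add_assoc, kernelBack, ih, kernelBack, add_assoc]

/-- `ρ` bounds the quadratic form on the orthogonal complement of the constant vectors. -/
def Contracts (h : Matrix (Fin n) (Fin n) ℝ) (ρ : ℝ) : Prop :=
  ∀ y : Fin n → ℝ, ∑ u, y u = 0 → quadForm h y ≤ ρ * ∑ u, y u ^ 2

theorem contracts_one : Contracts (1 : Matrix (Fin n) (Fin n) ℝ) 1 := fun y _ => by
  rw [quadForm_one, one_mul]

theorem Contracts.mono {h : Matrix (Fin n) (Fin n) ℝ} {ρ ρ' : ℝ} (H : Contracts h ρ)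
    (hρ : ρ ≤ ρ') : Contracts h ρ' := fun y hy =>
  (H y hy).trans (mul_le_mul_of_nonneg_right hρ (Finset.sum_nonneg fun _ _ => sq_nonneg _))

theorem Contracts.kernelStep {h : Matrix (Fin n) (Fin n) ℝ} {ρ : ℝ} (H : Contracts h ρ)
    (hρ : 0 ≤ ρ) (t : ℕ) : Contracts (kernelStep μ t h) ρ := fun y hy => by
  rw [quadForm_kernelStep]
  refine (pmfAvg_mono _ fun M => ?_).trans (pmfAvg_const (μ t) _).le
  exact (H _ (by rw [sum_mulVec, hy])).trans
    (mul_le_mul_of_nonneg_left (sum_sq_mulVec_le M y) hρ)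

theorem Contracts.kernelBack {h : Matrix (Fin n) (Fin n) ℝ} {ρ : ℝ} (H : Contracts h ρ)
    (hρ : 0 ≤ ρ) (r L : ℕ) : Contracts (kernelBack μ r L h) ρ := by
  induction L generalizing h with
  | zero => exact H
  | succ L ih => exact ih (H.kernelStep μ hρ _)

theorem sum_sub_inv_sq {φ : Fin n → ℝ} (hn : 0 < n) (hφ : ∑ u, φ u = 1) :
    ∑ u, (φ u - 1 / n) = 0 ∧ ∑ u, (φ u - 1 / n) ^ 2 = ∑ u, φ u ^ 2 - 1 / n := by
  have hn' : (n : ℝ) ≠ 0 := by positivity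
  constructor
  · rw [Finset.sum_sub_distrib, hφ]
    simp [hn']
  · have : ∀ u, (φ u - 1 / n) ^ 2 = φ u ^ 2 - 2 / n * φ u + 1 / n ^ 2 := fun u => by
      field_simp; ring
    simp only [this, Finset.sum_add_distrib, Finset.sum_sub_distrib, ← Finset.mul_sum, hφ]
    simp
    field_simp
    ring

/-- The unit vector at `w` minus its mean has quadratic form `h w w - 1 / n` and squared length
below 1, which bounds the diagonal; positive semidefiniteness bounds the rest by the diagonal. -/
theorem Contracts.apply_le {h : Matrix (Fin n) (Fin n) ℝ} {ρ : ℝ} (H : Contracts h ρ)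
    (hρ : 0 ≤ ρ) (hh : IsAveragingKernel h) (u v : Fin n) : h u v ≤ 1 / n + ρ := by
  have hn : 0 < n := u.pos
  have hn' : (n : ℝ) ≠ 0 := by positivity
  have diag : ∀ w, h w w ≤ 1 / n + ρ := by
    intro w
    set φ : Fin n → ℝ := fun z => if z = w then 1 else 0 with hφ
    obtain ⟨h1, h2⟩ := sum_sub_inv_sq hn (show ∑ z, φ z = 1 by simp [hφ])
    have h3 : ∑ z, φ z ^ 2 = 1 := by simp [hφ]
    have h4 := H _ h1
    rw [h2, h3] at h4
    have hcol : ∀ v, ∑ z, h z v = 1 := fun v => by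
      rw [← hh.sum_row v]; exact Finset.sum_congr rfl fun z _ => hh.symm _ _
    have h5 : quadForm h (fun z => φ z - 1 / n) = h w w - 1 / n := by
      have : ∀ a b, (φ a - 1 / (n : ℝ)) * (φ b - 1 / n) * h a b =
          φ a * (φ b * h a b) - φ a * (1 / n * h a b) - 1 / n * (φ b * h a b) +
            1 / n * (1 / n * h a b) := fun a b => by ring
      simp only [quadForm, this, Finset.sum_add_distrib, Finset.sum_sub_distrib,
        ← Finset.mul_sum, hh.sum_row]
      rw [Finset.sum_comm (f := fun a b => φ b * h a b)]
      simp only [← Finset.mul_sum, hcol]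
      simp [hφ]
      field_simp
      ring
    rw [h5] at h4
    have : 0 < 1 / (n : ℝ) := by positivity
    nlinarith
  have := hh.two_mul_le u v
  linarith [diag u, diag v]

end Kernels

/-! ### Contraction of the expected excess -/

section Excess

variable {n : ℕ} {G : SimpleGraph (Fin n)} (μ : ℕ → PMF (Matching G))

/-- The number of tokens above the first one of each node. -/
noncomputable def excess (x : Fin n → ℤ) : ℝ := ∑ u, ((max (x u - 1) 0 : ℤ) : ℝ)

theorem excess_nonneg (x : Fin n → ℤ) : 0 ≤ excess x :=
  Finset.sum_nonneg fun u _ => by exact_mod_cast le_max_right _ _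

theorem IsLoad.excess_le {m : ℤ} {x : Fin n → ℤ} (hx : IsLoad m x) : excess x ≤ m := by
  rw [← hx.2, excess]
  push_cast
  refine Finset.sum_le_sum fun u _ => max_le (by linarith) ?_
  exact_mod_cast hx.1 u

theorem collisionBound_kernelStep (t : ℕ) (h : Matrix (Fin n) (Fin n) ℝ) (x b : Fin n → ℤ) :
    collisionBound (kernelStep μ t h) x b =
      pmfAvg (μ t) fun M => collisionBound (matchingMatrix M * h * matchingMatrix M) x b := by
  simp only [collisionBound, sub_eq_add_neg _ (∑ u, _), ← Finset.sum_neg_distrib]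
  simp only [kernelStep, Matrix.of_apply, pmfAvg_add, pmfAvg_sum, pmfAvg_const_mul,
    ← neg_mul]

/-- Rounds are peeled off from the last one. The hypothesis ranges over all admissible `b` because
the unmarked load evolves along with `x`. -/
theorem expLoad_le_collisionBound {h : Matrix (Fin n) (Fin n) ℝ} (hh : IsAveragingKernel h)
    (r L : ℕ) {f : (Fin n → ℤ) → ℝ}
    (hf : ∀ x b : Fin n → ℤ, (∀ u, 0 ≤ b u) → (∀ u, b u ≤ 1) → (∀ u, b u ≤ x u) →
      f x ≤ collisionBound h x b)
    (x b : Fin n → ℤ) (hb : ∀ u, 0 ≤ b u) (hb1 : ∀ u, b u ≤ 1) (hbx : ∀ u, b u ≤ x u) :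
    expLoad μ r L f x ≤ collisionBound (kernelBack μ r L h) x b := by
  induction L generalizing f h with
  | zero => exact hf x b hb hb1 hbx
  | succ L ih =>
    refine ih (hh.kernelStep μ _) fun y d hd hd1 hdy => ?_
    rw [collisionBound_kernelStep]
    exact pmfAvg_mono _ fun M => (coinAvg_mono fun c => hf _ _ (balance_nonneg M c hd)
      (balance_le_one M c hd1) (balance_mono M c hdy)).trans
      (coinAvg_collisionBound_le M hh.symm hh.two_mul_le hd hdy)

theorem excess_le_collisionBound {x b : Fin n → ℤ} (hb : ∀ u, 0 ≤ b u) (hb1 : ∀ u, b u ≤ 1)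
    (hbx : ∀ u, b u ≤ x u) : excess x ≤ collisionBound 1 x b := by
  have e : collisionBound 1 x b = ∑ u, (((x u - b u) * (x u - 1) : ℤ) : ℝ) := by
    rw [collisionBound, ← Finset.sum_sub_distrib]
    refine Finset.sum_congr rfl fun u _ => ?_
    simp [Matrix.one_apply]
    ring
  rw [e, excess]
  refine Finset.sum_le_sum fun u _ => ?_
  have h0 := hb u
  have h1 := hb1 u
  have h2 := hbx u
  -- An empty node has `b u = 0`, a node with one token has vanishing second factor, and a node with
  -- at least two tokens has a marked one.
  have : max (x u - 1) 0 ≤ (x u - b u) * (x u - 1) := by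
    rcases le_or_gt (x u) 1 with h | h
    · rw [max_eq_right (by omega)]
      rcases h.lt_or_eq with h3 | h3
      · have : x u = 0 := by omega
        have : b u = 0 := by omega
        simp [*]
      · simp [h3]
    · rw [max_eq_left (by omega)]
      nlinarith
  exact_mod_cast this

theorem expLoad_excess_le {m : ℤ} (r L : ℕ) {η : ℝ} {x : Fin n → ℤ} (hx : IsLoad m x)
    (hη : ∀ u, ∑ v, (x v : ℝ) * kernelBack μ r L 1 u v ≤ η) :
    expLoad μ r L excess x ≤ η * excess x := by
  have hQ := isAveragingKernel_one.kernelBack μ r L (n := n)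
  have hd : ∀ u, ((max (x u - 1) 0 : ℤ) : ℝ) = (x u : ℝ) - (min (x u) 1 : ℤ) := by
    intro u
    rw [show max (x u - 1) 0 = x u - min (x u) 1 by omega]
    push_cast; ring
  -- With `b = min x 1` the marked tokens are exactly the excess tokens; the self-pair term is then
  -- dropped.
  refine (expLoad_le_collisionBound μ isAveragingKernel_one r L
    (fun y d h0 h1 h2 => excess_le_collisionBound h0 h1 h2) x (fun u => min (x u) 1)
    (fun u => le_min (hx.1 u) zero_le_one) (fun u => min_le_right _ _)
    (fun u => min_le_left _ _)).trans ?_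
  simp only [collisionBound, excess, ← hd]
  have h0 : ∀ u, (0 : ℝ) ≤ ((max (x u - 1) 0 : ℤ) : ℝ) := fun u => by
    exact_mod_cast le_max_right _ _
  have h1 : 0 ≤ ∑ u, ((max (x u - 1) 0 : ℤ) : ℝ) * kernelBack μ r L 1 u u :=
    Finset.sum_nonneg fun u _ => mul_nonneg (h0 u) (hQ.nonneg u u)
  refine (sub_le_self _ h1).trans ?_
  rw [Finset.mul_sum]
  refine Finset.sum_le_sum fun u _ => ?_
  simp only [mul_assoc, ← Finset.mul_sum]
  rw [mul_comm]
  exact mul_le_mul_of_nonneg_right (hη u) (h0 u)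

open Classical in
/-- The indicator function of a large weighted load. -/
noncomputable def tailIndicator (φ : Fin n → ℝ) (η : ℝ) (x : Fin n → ℤ) : ℝ :=
  if η < ∑ v, (x v : ℝ) * φ v then 1 else 0

theorem tailIndicator_nonneg (φ : Fin n → ℝ) (η : ℝ) (x : Fin n → ℤ) :
    0 ≤ tailIndicator φ η x := by
  unfold tailIndicator; split_ifs <;> norm_num

theorem tailIndicator_le_one (φ : Fin n → ℝ) (η : ℝ) (x : Fin n → ℤ) :
    tailIndicator φ η x ≤ 1 := by
  unfold tailIndicator; split_ifs <;> norm_num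

/-- If all weighted loads are small after `r` rounds, the excess contracts; otherwise it is still at
most `m`, and a union bound over the `n` nodes controls that event. -/
theorem expLoad_excess_add_le {m : ℤ} (r L : ℕ) {η F : ℝ} (hη : 0 ≤ η) {x : Fin n → ℤ}
    (hx : IsLoad m x)
    (hF : ∀ u, expLoad μ 0 r (tailIndicator (kernelBack μ r L 1 u) η) x ≤ F) :
    expLoad μ 0 (r + L) excess x ≤ η * expLoad μ 0 r excess x + m * (n * F) := by
  have hm : (0 : ℝ) ≤ m := by
    rw [← hx.2]; exact_mod_cast Finset.sum_nonneg fun u _ => hx.1 u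
  rw [expLoad_comp, zero_add]
  have key : ∀ y, IsLoad m y → expLoad μ r L excess y ≤
      η * excess y + m * ∑ u, tailIndicator (kernelBack μ r L 1 u) η y := by
    intro y hy
    by_cases h : ∀ u, ∑ v, (y v : ℝ) * kernelBack μ r L 1 u v ≤ η
    · refine (expLoad_excess_le μ r L hy h).trans (le_add_of_nonneg_right ?_)
      exact mul_nonneg hm (Finset.sum_nonneg fun u _ => tailIndicator_nonneg _ _ _)
    · push Not at h
      obtain ⟨u, hu⟩ := h
      have h1 : expLoad μ r L excess y ≤ m := by
        have := expLoad_mono μ r L (f := excess) (g := fun _ => (m : ℝ))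
          (fun z hz => hz.excess_le) y hy
        rwa [expLoad_const] at this
      have h2 : (1 : ℝ) ≤ ∑ u, tailIndicator (kernelBack μ r L 1 u) η y := by
        have : tailIndicator (kernelBack μ r L 1 u) η y = 1 := by
          unfold tailIndicator; rw [if_pos hu]
        rw [← this]
        exact Finset.single_le_sum (f := fun u => tailIndicator (kernelBack μ r L 1 u) η y)
          (fun v _ => tailIndicator_nonneg _ _ _) (Finset.mem_univ u)
      have h3 := mul_nonneg hη (excess_nonneg y)
      nlinarith
  refine (expLoad_mono μ 0 r key x hx).trans ?_
  rw [expLoad_add, expLoad_const_mul, expLoad_const_mul, expLoad_sum]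
  refine add_le_add le_rfl (mul_le_mul_of_nonneg_left ?_ hm)
  refine (Finset.sum_le_sum fun u _ => hF u).trans ?_
  simp

/-- The errors of the phases form a geometric series, whose sum is at most twice one error as `η ≤ 1
/ 2`. -/
theorem expLoad_excess_iterate {m : ℤ} (T L : ℕ) {η F : ℝ} (hη : 0 ≤ η) (hη' : η ≤ 1 / 2)
    (hF0 : 0 ≤ F) {x : Fin n → ℤ} (hx : IsLoad m x) (K : ℕ)
    (hF : ∀ j u, expLoad μ 0 (T + j * L)
      (tailIndicator (kernelBack μ (T + j * L) L 1 u) η) x ≤ F) :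
    expLoad μ 0 (T + K * L) excess x ≤ η ^ K * m + 2 * (m * (n * F)) := by
  have hm : (0 : ℝ) ≤ m := by
    rw [← hx.2]; exact_mod_cast Finset.sum_nonneg fun u _ => hx.1 u
  have hnF : 0 ≤ m * (n * F) := by positivity
  induction K with
  | zero =>
    have := expLoad_mono μ 0 T (f := excess) (g := fun _ => (m : ℝ))
      (fun z hz => hz.excess_le) x hx
    rw [expLoad_const] at this
    simpa using this.trans (le_add_of_nonneg_right (mul_nonneg zero_le_two hnF))
  | succ K ih =>
    have h1 := expLoad_excess_add_le μ (T + K * L) L hη hx (hF K)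
    rw [show T + (K + 1) * L = T + K * L + L by ring]
    have h2 := mul_le_mul_of_nonneg_left ih hη
    rw [pow_succ]
    nlinarith

/-- Markov's inequality: a node with two tokens forces excess at least 1. -/
theorem one_sub_expLoad_excess_le_prob {m : ℤ} {x : Fin n → ℤ} (hx : IsLoad m x) (t : ℕ) :
    1 - expLoad μ 0 t excess x ≤ prob (loadLaw μ x t) {y | ∀ u, |y u| ≤ 1} := by
  classical
  rw [prob_loadLaw]
  have h : expLoad μ 0 t (fun y => 1 + (-1) * excess y) x = 1 - expLoad μ 0 t excess x := by
    rw [expLoad_add, expLoad_const, expLoad_const_mul]; ring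
  rw [← h]
  refine expLoad_mono μ 0 t (fun y hy => ?_) x hx
  have h0 := excess_nonneg y
  by_cases hy1 : ∀ u, |y u| ≤ 1
  · rw [if_pos (show y ∈ {y : Fin n → ℤ | ∀ u, |y u| ≤ 1} from hy1)]
    linarith
  · rw [if_neg (show y ∉ {y : Fin n → ℤ | ∀ u, |y u| ≤ 1} from hy1)]
    push Not at hy1
    obtain ⟨u, hu⟩ := hy1
    rw [abs_of_nonneg (hy.1 u)] at hu
    have h1 : (1 : ℤ) ≤ max (y u - 1) 0 := le_max_of_le_left (by omega)
    have h2 : ((max (y u - 1) 0 : ℤ) : ℝ) ≤ excess y :=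
      Finset.single_le_sum (f := fun u => ((max (y u - 1) 0 : ℤ) : ℝ))
        (fun v _ => by exact_mod_cast le_max_right _ _) (Finset.mem_univ u)
    have h3 : (1 : ℝ) ≤ ((max (y u - 1) 0 : ℤ) : ℝ) := by exact_mod_cast h1
    linarith

end Excess

/-! ### Chernoff bounds for weighted loads -/

section Tail

variable {n : ℕ} {G : SimpleGraph (Fin n)}

/-- The expectation over the coins for given matchings, the last matching first. -/
noncomputable def coinExp : List (Matching G) → ((Fin n → ℤ) → ℝ) → (Fin n → ℤ) → ℝ
  | [], f => f
  | M :: l, f => coinExp l fun x => coinAvg fun c => f (balance M c x)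

/-- The successive averages of a vector over given matchings. -/
noncomputable def averageAlong : List (Matching G) → (Fin n → ℝ) → Fin n → ℝ
  | [], φ => φ
  | M :: l, φ => averageAlong l ((matchingMatrix M).mulVec φ)

theorem coinExp_mono {m : ℤ} (l : List (Matching G)) {f g : (Fin n → ℤ) → ℝ}
    (h : ∀ x, IsLoad m x → f x ≤ g x) (x : Fin n → ℤ) (hx : IsLoad m x) :
    coinExp l f x ≤ coinExp l g x := by
  induction l generalizing f g with
  | nil => exact h x hx
  | cons M l ih => exact ih fun y hy => coinAvg_mono fun c => h _ (hy.balance M c)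

theorem coinExp_const_mul (l : List (Matching G)) (a : ℝ) (f : (Fin n → ℤ) → ℝ) :
    coinExp l (fun x => a * f x) = fun x => a * coinExp l f x := by
  induction l generalizing f with
  | nil => rfl
  | cons M l ih =>
    simp only [coinExp]
    rw [← ih]
    simp only [coinAvg_const_mul]

theorem coinExp_const (l : List (Matching G)) (a : ℝ) :
    coinExp l (fun _ : Fin n → ℤ => a) = fun _ => a := by
  induction l with
  | nil => rfl
  | cons M l ih => simpa only [coinExp, coinAvg_const] using ih

theorem coinExp_pmfAvg {α : Type*} [Fintype α] (l : List (Matching G)) (q : PMF α)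
    (f : α → (Fin n → ℤ) → ℝ) :
    coinExp l (fun x => pmfAvg q fun a => f a x) = fun x => pmfAvg q fun a => coinExp l (f a) x := by
  induction l generalizing f with
  | nil => rfl
  | cons M l ih =>
    simp only [coinExp]
    rw [← ih]
    simp only [pmfAvg, coinAvg_sum, coinAvg_const_mul]

/-- Averaging is linear and fixes constants. This serves both the Chernoff base `1 + 2 φ / β` and
the splitting of `φ` into its mean and a sum-zero part. -/
theorem averageAlong_affine (l : List (Matching G)) (a b : ℝ) (φ : Fin n → ℝ) :
    averageAlong l (fun u => a + b * φ u) = fun u => a + b * averageAlong l φ u := by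
  induction l generalizing φ with
  | nil => rfl
  | cons M l ih =>
    simp only [averageAlong]
    rw [← ih]
    congr 1
    funext u
    simp only [matchingMatrix_mulVec]
    ring

theorem coinExp_prod_pow_le {m : ℤ} (l : List (Matching G)) {g : Fin n → ℝ} (hg : ∀ u, 0 < g u)
    {x : Fin n → ℤ} (hx : IsLoad m x) :
    coinExp l (fun y => ∏ u, g u ^ (y u).toNat) x ≤ ∏ u, averageAlong l g u ^ (x u).toNat := by
  induction l generalizing g with
  | nil => exact le_rfl
  | cons M l ih =>
    refine (coinExp_mono l (fun y hy => ?_) x hx).trans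
      (ih (g := (matchingMatrix M).mulVec g) fun u => ?_)
    · simp only [matchingMatrix_mulVec]
      exact coinAvg_prod_pow_le M hg hy.1
    · rw [matchingMatrix_mulVec]
      linarith [hg u, hg (partner M u)]

theorem exp_le_one_add_two_mul {y : ℝ} (h0 : 0 ≤ y) (h1 : y ≤ 1) : Real.exp y ≤ 1 + 2 * y := by
  have h := Real.abs_exp_sub_one_sub_id_le (x := y) (by rw [abs_le]; constructor <;> linarith)
  have := (abs_le.1 h).2
  nlinarith

theorem coinExp_tailIndicator_le {m : ℤ} (l : List (Matching G)) {φ : Fin n → ℝ} {β η : ℝ}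
    (hβ : 0 < β) (hφ0 : ∀ u, 0 ≤ φ u) (hφ : ∀ u, φ u ≤ β) {x : Fin n → ℤ} (hx : IsLoad m x) :
    coinExp l (tailIndicator φ η) x ≤
      Real.exp (-(η / β)) * Real.exp (2 / β * ∑ u, (x u : ℝ) * averageAlong l φ u) := by
  have h1 : ∀ y, IsLoad m y → tailIndicator φ η y ≤
      Real.exp (-(η / β)) * ∏ u, (1 + 2 / β * φ u) ^ (y u).toNat := by
    intro y hy
    -- The exponential is replaced by an affine base, on which averaging acts explicitly; `φ u ≤ β`
    -- keeps the exponent per token in `[0, 1]`.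
    have hle : Real.exp (∑ v, (y v : ℝ) * (φ v / β)) ≤ ∏ u, (1 + 2 / β * φ u) ^ (y u).toNat := by
      rw [Real.exp_sum]
      refine Finset.prod_le_prod (fun u _ => (Real.exp_pos _).le) fun u _ => ?_
      have h2 : ((y u).toNat : ℝ) = y u := by
        exact_mod_cast congrArg (Int.cast (R := ℝ)) (Int.toNat_of_nonneg (hy.1 u))
      rw [← h2, Real.exp_nat_mul]
      refine pow_le_pow_left₀ (Real.exp_pos _).le ?_ _
      refine (exp_le_one_add_two_mul (div_nonneg (hφ0 u) hβ.le)
        ((div_le_one hβ).2 (hφ u))).trans (le_of_eq ?_)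
      ring
    refine le_trans ?_ (mul_le_mul_of_nonneg_left hle (Real.exp_pos _).le)
    rw [← Real.exp_add]
    unfold tailIndicator
    split_ifs with h
    · refine Real.one_le_exp ?_
      have : ∑ v, (y v : ℝ) * (φ v / β) = (∑ v, (y v : ℝ) * φ v) / β := by
        rw [Finset.sum_div]; exact Finset.sum_congr rfl fun v _ => by ring
      rw [this, neg_add_eq_sub, ← sub_div]
      exact div_nonneg (sub_nonneg.2 h.le) hβ.le
    · exact (Real.exp_pos _).le
  refine (coinExp_mono l h1 x hx).trans ?_
  rw [coinExp_const_mul]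
  refine mul_le_mul_of_nonneg_left ?_ (Real.exp_pos _).le
  refine (coinExp_prod_pow_le l (fun u => ?_) hx).trans ?_
  · have := hφ0 u
    positivity
  · rw [averageAlong_affine, Finset.mul_sum, Real.exp_sum]
    have hA : ∀ u, 0 ≤ averageAlong l φ u := by
      clear h1 hφ
      induction l generalizing φ with
      | nil => exact hφ0
      | cons M l ih =>
        refine ih fun u => ?_
        rw [matchingMatrix_mulVec]
        linarith [hφ0 u, hφ0 (partner M u)]
    refine Finset.prod_le_prod (fun u _ => by have := hA u; positivity) fun u _ => ?_
    have h2 : ((x u).toNat : ℝ) = x u := by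
      exact_mod_cast congrArg (Int.cast (R := ℝ)) (Int.toNat_of_nonneg (hx.1 u))
    rw [← h2, mul_left_comm, Real.exp_nat_mul]
    refine pow_le_pow_left₀ (by have := hA u; positivity) ?_ _
    exact (add_comm _ _).trans_le (Real.add_one_le_exp _)

variable (μ : ℕ → PMF (Matching G))

/-- The expectation over the matchings of the first `t` rounds, the last matching first. -/
noncomputable def seqAvg : ℕ → (List (Matching G) → ℝ) → ℝ
  | 0, F => F []
  | t + 1, F => pmfAvg (μ t) fun M => seqAvg t fun l => F (M :: l)

theorem seqAvg_mono (t : ℕ) {F F' : List (Matching G) → ℝ} (h : ∀ l, F l ≤ F' l) :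
    seqAvg μ t F ≤ seqAvg μ t F' := by
  induction t generalizing F F' with
  | zero => exact h _
  | succ t ih => exact pmfAvg_mono _ fun M => ih fun l => h _

theorem seqAvg_const_mul_add (t : ℕ) (F : List (Matching G) → ℝ) (a b : ℝ) :
    seqAvg μ t (fun l => a * F l + b) = a * seqAvg μ t F + b := by
  induction t generalizing F with
  | zero => rfl
  | succ t ih => simp only [seqAvg, ih, pmfAvg_add, pmfAvg_const_mul, pmfAvg_const]

theorem seqAvg_pmfAvg {α : Type*} [Fintype α] (q : PMF α) (t : ℕ)
    (F : α → List (Matching G) → ℝ) :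
    seqAvg μ t (fun l => pmfAvg q fun a => F a l) = pmfAvg q fun a => seqAvg μ t (F a) := by
  induction t generalizing F with
  | zero => rfl
  | succ t ih =>
    simp only [seqAvg, ih]
    simp only [pmfAvg, Finset.mul_sum]
    rw [Finset.sum_comm]
    exact Finset.sum_congr rfl fun _ _ => Finset.sum_congr rfl fun _ _ => by ring

/-- Matchings are independent of coins and loads, so one may condition on all matchings and average
over the coins first. -/
theorem expLoad_eq_seqAvg (t : ℕ) (f : (Fin n → ℤ) → ℝ) (x : Fin n → ℤ) :
    expLoad μ 0 t f x = seqAvg μ t fun l => coinExp l f x := by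
  induction t generalizing f with
  | zero => rfl
  | succ t ih =>
    rw [expLoad, ih, seqAvg]
    simp only [coinExp]
    rw [← seqAvg_pmfAvg]
    congr 1
    funext l
    have := congrFun (coinExp_pmfAvg l (μ t) fun M x => coinAvg fun c => f (balance M c x)) x
    rwa [zero_add]

/-- The weights are averaged backwards in time, the first round acting last; hence `kernelForth` and
not `kernelBack`. -/
theorem seqAvg_sum_sq (t : ℕ) (φ : Fin n → ℝ) :
    seqAvg μ t (fun l => ∑ u, averageAlong l φ u ^ 2) = quadForm (kernelForth μ t) φ := by
  induction t generalizing φ with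
  | zero => exact (quadForm_one φ).symm
  | succ t ih => simp only [seqAvg, averageAlong, ih, kernelForth, quadForm_kernelStep]

/-- The tail of a weighted load once the averages have mixed. -/
theorem expLoad_tailIndicator_le {m : ℤ} (t : ℕ) {φ : Fin n → ℝ} {β η ρ : ℝ} (hn : 0 < n)
    (hβ : 0 < β) (hφ0 : ∀ u, 0 ≤ φ u) (hφ : ∀ u, φ u ≤ β) (hφ1 : ∑ u, φ u = 1) (hρ : 0 ≤ ρ)
    (hmix : Contracts (kernelForth μ t) ρ) {x : Fin n → ℤ} (hx : IsLoad m x) :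
    expLoad μ 0 t (tailIndicator φ η) x ≤
      n ^ 2 * ρ + Real.exp (-(η / β) + 4 * (m / n) / β) := by
  have hn' : (0 : ℝ) < n := by exact_mod_cast hn
  set ψ : Fin n → ℝ := fun u => φ u - 1 / n with hψ
  obtain ⟨hψ0, hψ2⟩ := sum_sub_inv_sq hn hφ1
  have hψ1 : ∑ u, ψ u ^ 2 ≤ 1 := by
    have : ∑ u, φ u ^ 2 ≤ ∑ u, φ u := Finset.sum_le_sum fun u _ => by
      have : φ u ≤ 1 := hφ1 ▸ Finset.single_le_sum (fun v _ => hφ0 v) (Finset.mem_univ u)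
      nlinarith [hφ0 u]
    have : 0 < 1 / (n : ℝ) := by positivity
    linarith
  rw [expLoad_eq_seqAvg]
  refine (seqAvg_mono μ t (F' := fun l => (n : ℝ) ^ 2 * ∑ u, averageAlong l ψ u ^ 2 +
    Real.exp (-(η / β) + 4 * (m / n) / β)) fun l => ?_).trans ?_
  · have hS : 0 ≤ ∑ u, averageAlong l ψ u ^ 2 := Finset.sum_nonneg fun u _ => sq_nonneg _
    -- Matching sequences that fail to mix are charged to the first term, which is at least 1 for
    -- them; for all others every averaged weight is at most `2 / n`.
    by_cases hl : 1 ≤ (n : ℝ) ^ 2 * ∑ u, averageAlong l ψ u ^ 2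
    · have := coinExp_mono l (f := tailIndicator φ η) (g := fun _ => 1)
        (fun y _ => tailIndicator_le_one _ _ _) x hx
      rw [coinExp_const] at this
      linarith [Real.exp_pos (-(η / β) + 4 * (m / n) / β)]
    · push Not at hl
      refine le_trans ?_ (le_add_of_nonneg_left (by positivity))
      refine (coinExp_tailIndicator_le l hβ hφ0 hφ hx).trans ?_
      rw [← Real.exp_add]
      refine Real.exp_le_exp.2 (add_le_add le_rfl ?_)
      have hav : ∀ u, averageAlong l φ u ≤ 2 / n := by
        intro u
        have e : φ = fun u => 1 / n + 1 * ψ u := by funext u; simp only [hψ]; ring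
        rw [e, averageAlong_affine]
        have h1 : averageAlong l ψ u ^ 2 ≤ ∑ u, averageAlong l ψ u ^ 2 :=
          Finset.single_le_sum (f := fun u => averageAlong l ψ u ^ 2) (fun v _ => sq_nonneg _)
            (Finset.mem_univ u)
        have h2 : ((n : ℝ) * averageAlong l ψ u) ^ 2 ≤ 1 := by
          rw [mul_pow]
          exact (mul_le_mul_of_nonneg_left h1 (by positivity)).trans hl.le
        have h3 : (n : ℝ) * averageAlong l ψ u ≤ 1 := by nlinarith
        have h4 : averageAlong l ψ u ≤ 1 / n := by rwa [le_div_iff₀ hn', mul_comm]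
        linarith [show (2 : ℝ) / n = 1 / n + 1 / n by ring]
      have hsum : ∑ u, (x u : ℝ) * averageAlong l φ u ≤ m * (2 / n) := by
        rw [← hx.2]
        push_cast
        rw [Finset.sum_mul]
        exact Finset.sum_le_sum fun u _ =>
          mul_le_mul_of_nonneg_left (hav u) (by exact_mod_cast hx.1 u)
      calc 2 / β * ∑ u, (x u : ℝ) * averageAlong l φ u ≤ 2 / β * (m * (2 / n)) :=
            mul_le_mul_of_nonneg_left hsum (by positivity)
        _ = 4 * (m / n) / β := by ring
  · rw [seqAvg_const_mul_add, seqAvg_sum_sq]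
    refine add_le_add (mul_le_mul_of_nonneg_left ?_ (by positivity)) le_rfl
    exact (hmix ψ hψ0).trans (mul_le_of_le_one_right hρ hψ1)

end Tail

/-! ### Choice of parameters and the model-independent bound -/

theorem ceil_mul_ceil_le {s γ : ℝ} (hs : 100 ≤ s) (hγ : 0 < γ) (hγ2 : γ ≤ 2) :
    (⌈6 * s⌉₊ : ℝ) * ⌈(s + 5) / γ⌉₊ ≤ 14 * s ^ 2 / γ := by
  have h1 : (⌈6 * s⌉₊ : ℝ) ≤ 7 * s := by
    have := (Nat.ceil_lt_add_one (a := 6 * s) (by linarith)).le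
    linarith
  have h2 : (⌈(s + 5) / γ⌉₊ : ℝ) ≤ 2 * s / γ := by
    have := (Nat.ceil_lt_add_one (a := (s + 5) / γ) (by positivity)).le
    refine this.trans ?_
    rw [← sub_nonneg]
    have e : 2 * s / γ - ((s + 5) / γ + 1) = (s - 5 - γ) / γ := by field_simp; ring
    rw [e]
    exact div_nonneg (by linarith) hγ.le
  calc (⌈6 * s⌉₊ : ℝ) * ⌈(s + 5) / γ⌉₊ ≤ (7 * s) * (2 * s / γ) :=
        mul_le_mul h1 h2 (by positivity) (by positivity)
    _ = 14 * s ^ 2 / γ := by ring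

theorem exp_half_ge {s : ℝ} (hs : 100 ≤ s) : 4 + 10 * s ^ 2 ≤ Real.exp (s / 2) := by
  have h := Real.pow_div_factorial_le_exp (x := s / 2) (by linarith) 4
  refine le_trans ?_ h
  have h2 : (10000 : ℝ) ≤ s ^ 2 := by nlinarith
  have e : (s / 2) ^ 4 / ((Nat.factorial 4 : ℕ) : ℝ) = s ^ 2 * s ^ 2 / 384 := by
    norm_num [Nat.factorial]; ring
  rw [e]
  nlinarith

/-- If averaging mixes at rate `γ`, then sparse loads are spread after `O(log n / γ)` rounds. -/
theorem one_sub_le_prob_of_contracts {n : ℕ} (hn : Real.exp 10000 ≤ n) {G : SimpleGraph (Fin n)}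
    (μ : ℕ → PMF (Matching G)) {γ : ℝ} (hγ : 0 < γ) (hγ2 : γ ≤ 2)
    (hback : ∀ r L : ℕ, Contracts (kernelBack μ r L 1) (Real.exp (4 - γ * L)))
    (hforth : ∀ t : ℕ, Contracts (kernelForth μ t) (Real.exp (4 - γ * t)))
    {ε : ℝ} (hε : ε < 1 / 2) {x : Fin n → ℤ} (hx : IsSparseLoad ε x) {κ : ℕ}
    (hκ : 25 * (Real.log n / γ) ≤ κ) :
    1 - 5 / (n : ℝ) ≤ prob (loadLaw μ x κ) {y | ∀ u, |y u| ≤ 1} := by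
  have hn0 : (0 : ℝ) < n := (Real.exp_pos _).trans_le hn
  have hnN : 0 < n := by exact_mod_cast hn0
  have hlog : 10000 ≤ Real.log n := by
    rw [← Real.log_exp 10000]; exact Real.log_le_log (Real.exp_pos _) hn
  set s : ℝ := Real.sqrt (Real.log n) with hs_def
  have hs2 : s ^ 2 = Real.log n := Real.sq_sqrt (by linarith)
  have hs : 100 ≤ s := Real.le_sqrt_of_sq_le (by linarith)
  have hne : (n : ℝ) = Real.exp (s ^ 2) := by rw [hs2, Real.exp_log hn0]
  obtain ⟨m, hxm⟩ : ∃ m, IsLoad m x := ⟨_, hx.1, rfl⟩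
  -- Here `ε < 1 / 2` enters: `(log n) ^ (1 - ε)` is at least `(log n) ^ (1 / 2) = s`.
  have hmn : (m : ℝ) ≤ n * Real.exp (-s) := by
    have h1 : (m : ℝ) ≤ n * Real.exp (-(Real.log n) ^ (1 - ε)) := by
      refine le_trans (le_of_eq ?_) hx.2
      rw [← hxm.2]
      congr 1
      exact Finset.sum_congr rfl fun u _ => (abs_of_nonneg (hx.1 u)).symm
    refine h1.trans (mul_le_mul_of_nonneg_left (Real.exp_le_exp.2 (neg_le_neg ?_)) hn0.le)
    rw [hs_def, Real.sqrt_eq_rpow]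
    exact Real.rpow_le_rpow_of_exponent_le (by linarith) (by linarith)
  have hm0 : (0 : ℝ) ≤ m := by
    rw [← hxm.2]; exact_mod_cast Finset.sum_nonneg fun u _ => hx.1 u
  set L := ⌈(s + 5) / γ⌉₊ with hL
  set K := ⌈6 * s⌉₊ with hK
  have hKL : (K : ℝ) * L ≤ 14 * s ^ 2 / γ := ceil_mul_ceil_le hs hγ hγ2
  have hκ' : 25 * s ^ 2 / γ ≤ κ := by rw [hs2, mul_div_assoc]; exact hκ
  have hKLκ : K * L ≤ κ := by
    have : (K : ℝ) * L ≤ κ := hKL.trans (le_trans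
      (div_le_div_of_nonneg_right (by nlinarith) hγ.le) hκ')
    exact_mod_cast this
  -- The `K` phases take at most `14 s ^ 2 / γ` rounds. The other `T ≥ 11 s ^ 2 / γ` rounds come
  -- first and mix the matchings so well that even `n ^ 2 * exp (4 - γ T)` is at most `n ^ (-5)`.
  obtain ⟨T, rfl⟩ : ∃ T, κ = T + K * L := ⟨κ - K * L, by omega⟩
  have hT : 7 * s ^ 2 + 4 ≤ γ * T := by
    push_cast at hκ'
    have h1 : 11 * s ^ 2 / γ ≤ T := by
      have : 11 * s ^ 2 / γ = 25 * s ^ 2 / γ - 14 * s ^ 2 / γ := by ring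
      linarith
    rw [div_le_iff₀ hγ] at h1
    nlinarith
  have hLγ : s + 5 ≤ γ * L := by
    have := Nat.le_ceil ((s + 5) / γ)
    rw [← hL, div_le_iff₀ hγ] at this
    linarith
  set η := Real.exp (-(s / 2)) with hη
  set β := 2 * Real.exp (-s) with hβ
  have hβ0 : 0 < β := by positivity
  have hη2 : η ≤ 1 / 2 := by
    rw [hη, Real.exp_neg, one_div]
    refine inv_anti₀ two_pos ?_
    linarith [Real.add_one_le_exp (s / 2)]
  have hηβ : η / β = Real.exp (s / 2) / 2 := by
    rw [hη, hβ, div_eq_div_iff (by positivity) two_ne_zero]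
    have : Real.exp (s / 2) * Real.exp (-s) = Real.exp (-(s / 2)) := by
      rw [← Real.exp_add]; congr 1; ring
    linear_combination (-2) * this
  have hF : ∀ j u, expLoad μ 0 (T + j * L)
      (tailIndicator (kernelBack μ (T + j * L) L 1 u) η) x ≤ 2 * Real.exp (-(5 * s ^ 2)) := by
    intro j u
    set r := T + j * L with hr
    have hQ := isAveragingKernel_one.kernelBack μ r L (n := n)
    have hle : ∀ v, kernelBack μ r L 1 u v ≤ β := by
      intro v
      refine ((hback r L).apply_le (Real.exp_pos _).le hQ u v).trans ?_
      have h1 : 1 / (n : ℝ) ≤ Real.exp (-s) := by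
        rw [hne, one_div, ← Real.exp_neg]
        exact Real.exp_le_exp.2 (by nlinarith)
      have h2 : Real.exp (4 - γ * L) ≤ Real.exp (-s) := Real.exp_le_exp.2 (by linarith)
      rw [hβ]; linarith
    refine (expLoad_tailIndicator_le μ r hnN hβ0 (hQ.nonneg u) hle (hQ.sum_row u)
      (Real.exp_pos _).le (hforth r) hxm).trans ?_
    rw [two_mul]
    refine add_le_add ?_ (Real.exp_le_exp.2 ?_)
    · rw [hne, ← Real.exp_nat_mul, ← Real.exp_add]
      refine Real.exp_le_exp.2 ?_
      have : γ * T ≤ γ * r := by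
        refine mul_le_mul_of_nonneg_left ?_ hγ.le
        exact_mod_cast Nat.le_add_right T (j * L)
      push_cast
      linarith
    -- The mean contributes at most 2 to the exponent, while `η / β = exp (s / 2) / 2 ≥ 2 + 5 s ^
    -- 2`.
    · have h1 : (m : ℝ) / n / β ≤ 1 / 2 := by
        rw [div_le_iff₀ hβ0, div_le_iff₀ hn0, hβ]
        linarith
      have h2 : 4 * ((m : ℝ) / n) / β = 4 * (m / n / β) := by ring
      rw [hηβ, h2]
      linarith [exp_half_ge hs]
  have hY := expLoad_excess_iterate μ T L (Real.exp_pos _).le hη2 (by positivity) hxm K hF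
  refine le_trans ?_ (one_sub_expLoad_excess_le_prob μ hxm _)
  refine sub_le_sub_left (hY.trans ?_) _
  have hmn' : (m : ℝ) ≤ n := hmn.trans
    (mul_le_of_le_one_right hn0.le (Real.exp_le_one_iff.2 (by linarith)))
  have hηK : η ^ K ≤ Real.exp (-(3 * s ^ 2)) := by
    rw [hη, ← Real.exp_nat_mul]
    refine Real.exp_le_exp.2 ?_
    have := Nat.le_ceil (6 * s)
    rw [← hK] at this
    nlinarith
  have e3 : Real.exp (-(3 * s ^ 2)) = ((n : ℝ) ^ 3)⁻¹ := by
    rw [hne, ← Real.exp_nat_mul, ← Real.exp_neg]; norm_num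
  have e5 : Real.exp (-(5 * s ^ 2)) = ((n : ℝ) ^ 5)⁻¹ := by
    rw [hne, ← Real.exp_nat_mul, ← Real.exp_neg]; norm_num
  have hn1 : (1 : ℝ) ≤ n := by exact_mod_cast hnN
  calc η ^ K * m + 2 * (m * (n * (2 * Real.exp (-(5 * s ^ 2)))))
      ≤ ((n : ℝ) ^ 3)⁻¹ * n + 2 * (n * (n * (2 * ((n : ℝ) ^ 5)⁻¹))) := by
        rw [e5]
        refine add_le_add (mul_le_mul (e3 ▸ hηK) hmn' hm0 (by positivity)) ?_
        gcongr
    _ = ((n : ℝ) ^ 2)⁻¹ + 4 * ((n : ℝ) ^ 3)⁻¹ := by field_simp; ring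
    _ ≤ (n : ℝ)⁻¹ + 4 * (n : ℝ)⁻¹ := by
        gcongr
        · exact le_self_pow₀ hn1 two_ne_zero
        · exact le_self_pow₀ hn1 three_ne_zero
    _ = 5 / n := by ring

/-! ### Spectral decomposition and `lam` -/

section Spectral

variable {n : ℕ} {A : Matrix (Fin n) (Fin n) ℝ} (hA : A.IsHermitian)

/-- The eigenvalues are sorted, so away from the top index `i₀` their absolute values are largest at
one of the two ends, position 1 or `n - 1`. -/
theorem exists_orthonormal_eigenvectors (hn : 2 ≤ n) :
    ∃ (l : Fin n → ℝ) (v : Fin n → Fin n → ℝ) (i₀ : Fin n),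
      (∀ i, A.mulVec (v i) = l i • v i) ∧
      (∀ i j, v i ⬝ᵥ v j = if i = j then 1 else 0) ∧
      (∀ y z : Fin n → ℝ, y ⬝ᵥ z = ∑ i, (v i ⬝ᵥ y) * (v i ⬝ᵥ z)) ∧
      (∀ i, l i ≤ l i₀) ∧ (∀ i, i ≠ i₀ → |l i| ≤ lam A hA) ∧ ∃ i, i ≠ i₀ ∧ lam A hA = |l i| := by
  set e : Fin (Fintype.card (Fin n)) ≃ Fin n := Fintype.equivOfCardEq (Fintype.card_fin _) with he
  have hcard : Fintype.card (Fin n) = n := Fintype.card_fin n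
  have hl : ∀ i, hA.eigenvalues i = hA.eigenvalues₀ (e.symm i) := fun i => rfl
  have hlam : lam A hA = max |hA.eigenvalues₀ ⟨1, by omega⟩| |hA.eigenvalues₀ ⟨n - 1, by omega⟩| := by
    unfold lam; rw [dif_pos hn]
  have hinner : ∀ x y : EuclideanSpace ℝ (Fin n), inner ℝ x y = (x : Fin n → ℝ) ⬝ᵥ (y : Fin n → ℝ) := by
    intro x y
    rw [PiLp.inner_apply, dotProduct]
    exact Finset.sum_congr rfl fun u _ => by simp [mul_comm]
  refine ⟨hA.eigenvalues, fun i => hA.eigenvectorBasis i, e ⟨0, by omega⟩,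
    hA.mulVec_eigenvectorBasis, fun i j => ?_, fun y z => ?_, fun i => ?_, fun i hi => ?_, ?_⟩
  · rw [← hinner]
    exact orthonormal_iff_ite.1 hA.eigenvectorBasis.orthonormal i j
  · have := hA.eigenvectorBasis.sum_inner_mul_inner (WithLp.toLp 2 y) (WithLp.toLp 2 z)
    simp only [hinner] at this
    rw [← this]
    exact Finset.sum_congr rfl fun i _ => by rw [dotProduct_comm y]
  · rw [hl, hl]
    refine hA.eigenvalues₀_antitone ?_
    rw [Equiv.symm_apply_apply]
    exact Nat.zero_le _
  · have h1 : (e.symm i).1 ≠ 0 := by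
      intro h
      apply hi
      rw [← Equiv.symm_apply_eq]
      exact Fin.ext h
    have h2 := (e.symm i).2
    rw [hlam, hl, max_comm]
    refine abs_le_max_abs_abs (hA.eigenvalues₀_antitone ?_) (hA.eigenvalues₀_antitone ?_)
    · rw [Fin.le_def]; dsimp only; omega
    · rw [Fin.le_def]; dsimp only; omega
  · rcases max_choice |hA.eigenvalues₀ ⟨1, by omega⟩| |hA.eigenvalues₀ ⟨n - 1, by omega⟩| with h | h
    · refine ⟨e ⟨1, by omega⟩, fun hh => ?_, ?_⟩
      · have := congrArg Fin.val (e.injective hh)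
        simp at this
      · rw [hlam, h, hl, Equiv.symm_apply_apply]
    · refine ⟨e ⟨n - 1, by omega⟩, fun hh => ?_, ?_⟩
      · have := congrArg Fin.val (e.injective hh)
        simp at this
        omega
      · rw [hlam, h, hl, Equiv.symm_apply_apply]

theorem lam_nonneg : 0 ≤ lam A hA := by
  unfold lam
  split_ifs
  · exact le_max_of_le_left (abs_nonneg _)
  · exact le_rfl

theorem dotProduct_mulVec_comm_of_isHermitian {A : Matrix (Fin n) (Fin n) ℝ}
    (hA : A.IsHermitian) (y z : Fin n → ℝ) :
    y ⬝ᵥ A.mulVec z = A.mulVec y ⬝ᵥ z := by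
  have hT : A.transpose = A := by
    rw [← Matrix.conjTranspose_eq_transpose_of_trivial]; exact hA
  rw [Matrix.dotProduct_mulVec, ← Matrix.mulVec_transpose, hT]

/-- On the complement of the constant vectors, a symmetric matrix that fixes the constants is
bounded by `λ`. -/
theorem lam_contraction (hn : 2 ≤ n) (h1 : A.mulVec 1 = 1) (hlt : lam A hA < 1)
    {y : Fin n → ℝ} (hy : ∑ u, y u = 0) :
    y ⬝ᵥ A.mulVec y ≤ lam A hA * ∑ u, y u ^ 2 ∧
      ∑ u, A.mulVec y u ^ 2 ≤ lam A hA ^ 2 * ∑ u, y u ^ 2 := by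
  obtain ⟨l, v, i₀, hv, -, hpars, -, hl, -⟩ := exists_orthonormal_eigenvectors hA hn
  have hc : ∀ i z, v i ⬝ᵥ A.mulVec z = l i * (v i ⬝ᵥ z) := fun i z => by
    rw [dotProduct_mulVec_comm_of_isHermitian hA, hv, smul_dotProduct, smul_eq_mul]
  -- The constants have eigenvalue 1 and all eigenvalues off `i₀` are below 1. Hence `v i₀` spans
  -- the constants, and a sum-zero vector has no component along it.
  have hone : ∀ i, i ≠ i₀ → v i ⬝ᵥ (1 : Fin n → ℝ) = 0 := by
    intro i hi
    have h2 := hc i 1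
    rw [h1] at h2
    have h3 : l i < 1 := (le_abs_self _).trans_lt ((hl i hi).trans_lt hlt)
    have h4 : (1 - l i) * (v i ⬝ᵥ (1 : Fin n → ℝ)) = 0 := by linarith
    exact (mul_eq_zero.1 h4).resolve_left (by linarith)
  have hsum : ∀ z : Fin n → ℝ, ∑ u, z u = (v i₀ ⬝ᵥ z) * (v i₀ ⬝ᵥ (1 : Fin n → ℝ)) := by
    intro z
    have := hpars z 1
    rw [Finset.sum_eq_single i₀ (fun i _ hi => by rw [hone i hi, mul_zero]) (by simp)] at this
    rw [← this, dotProduct_one]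
  have hne : v i₀ ⬝ᵥ (1 : Fin n → ℝ) ≠ 0 := by
    intro h
    have := hsum 1
    rw [h, mul_zero] at this
    simp at this
    omega
  have hy0 : v i₀ ⬝ᵥ y = 0 := by
    have := hsum y
    rw [hy] at this
    exact (mul_eq_zero.1 this.symm).resolve_right hne
  have hsq : ∀ z : Fin n → ℝ, ∑ u, z u ^ 2 = ∑ i, (v i ⬝ᵥ z) ^ 2 := by
    intro z
    have := hpars z z
    simp only [← sq] at this
    rw [← this, dotProduct]
    exact Finset.sum_congr rfl fun u _ => sq _
  constructor
  · rw [hpars, hsq, Finset.mul_sum]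
    refine Finset.sum_le_sum fun i _ => ?_
    rw [hc]
    by_cases hi : i = i₀
    · subst hi; rw [hy0]; simp
    · nlinarith [sq_nonneg (v i ⬝ᵥ y), (le_abs_self _).trans (hl i hi)]
  · rw [hsq (A.mulVec y), hsq y, Finset.mul_sum]
    refine Finset.sum_le_sum fun i _ => ?_
    rw [hc]
    by_cases hi : i = i₀
    · subst hi; rw [hy0]; simp
    · rw [mul_pow]
      refine mul_le_mul_of_nonneg_right ?_ (sq_nonneg _)
      rw [← sq_abs (l i)]
      exact pow_le_pow_left₀ (abs_nonneg _) (hl i hi) 2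

end Spectral

/-! ### The balancing circuit: contraction per period -/

section Circuit

variable {n d : ℕ} {G : SimpleGraph (Fin n)}

theorem matchingMatrix_mulVec_one (M : Matching G) : (matchingMatrix M).mulVec 1 = 1 := by
  funext u
  rw [matchingMatrix_mulVec]
  simp

variable (hd : 0 < d) (M : Fin d → Matching G)

/-- The product of the first `k` matching matrices of the circuit. -/
noncomputable def prefixMatrix (k : ℕ) : Matrix (Fin n) (Fin n) ℝ :=
  ((List.range k).map fun t => matchingMatrix (M ⟨t % d, Nat.mod_lt t hd⟩)).prod

theorem prefixMatrix_succ (k : ℕ) : prefixMatrix hd M (k + 1) =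
    prefixMatrix hd M k * matchingMatrix (M ⟨k % d, Nat.mod_lt k hd⟩) := by
  unfold prefixMatrix
  rw [List.prod_range_succ]

theorem prefixMatrix_period : prefixMatrix hd M d = roundMatrix M := by
  unfold prefixMatrix roundMatrix
  congr 1
  refine List.ext_getElem (by simp) fun i h1 h2 => ?_
  have hi : i < d := by simpa using h1
  simp [Nat.mod_eq_of_lt hi]

theorem prefixMatrix_mulVec_one (k : ℕ) : (prefixMatrix hd M k).mulVec 1 = 1 := by
  induction k with
  | zero => simp [prefixMatrix]
  | succ k ih => rw [prefixMatrix_succ, ← Matrix.mulVec_mulVec, matchingMatrix_mulVec_one, ih]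

theorem prefixMatrix_transpose_mulVec_one (k : ℕ) :
    (prefixMatrix hd M k).transpose.mulVec 1 = 1 := by
  induction k with
  | zero => simp [prefixMatrix]
  | succ k ih =>
    rw [prefixMatrix_succ, Matrix.transpose_mul, ← Matrix.mulVec_mulVec, ih,
      matchingMatrix_transpose, matchingMatrix_mulVec_one]

theorem sum_mulVec_of_transpose {A : Matrix (Fin n) (Fin n) ℝ} (h : A.transpose.mulVec 1 = 1)
    (y : Fin n → ℝ) : ∑ u, A.mulVec y u = ∑ u, y u := by
  rw [← dotProduct_one, ← dotProduct_one, dotProduct_comm, Matrix.dotProduct_mulVec,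
    ← Matrix.mulVec_transpose, h, dotProduct_comm]

theorem roundLam_nonneg (A : Matrix (Fin n) (Fin n) ℝ) : 0 ≤ roundLam A := by
  unfold roundLam
  split_ifs
  · exact lam_nonneg _
  · exact Real.sqrt_nonneg _

theorem sum_sq_mulVec_eq (A : Matrix (Fin n) (Fin n) ℝ) (y : Fin n → ℝ) :
    ∑ u, A.mulVec y u ^ 2 = y ⬝ᵥ (A.transpose * A).mulVec y := by
  rw [← Matrix.mulVec_mulVec, Matrix.dotProduct_mulVec, Matrix.vecMul_transpose, dotProduct]
  exact Finset.sum_congr rfl fun u _ => sq _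

theorem roundLam_contraction {A : Matrix (Fin n) (Fin n) ℝ} (hn : 2 ≤ n) (h1 : A.mulVec 1 = 1)
    (h2 : A.transpose.mulVec 1 = 1) (hlt : roundLam A < 1) {y : Fin n → ℝ} (hy : ∑ u, y u = 0) :
    ∑ u, A.mulVec y u ^ 2 ≤ roundLam A ^ 2 * ∑ u, y u ^ 2 := by
  unfold roundLam at hlt ⊢
  split_ifs at hlt ⊢ with hA
  · exact (lam_contraction hA hn h1 hlt hy).2
  · have hH := Matrix.isHermitian_conjTranspose_mul_self A
    have hlt' : lam (A.conjTranspose * A) hH < 1 := by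
      rwa [Real.sqrt_lt' one_pos, one_pow] at hlt
    rw [Real.sq_sqrt (lam_nonneg hH), sum_sq_mulVec_eq,
      ← Matrix.conjTranspose_eq_transpose_of_trivial]
    refine (lam_contraction hH hn ?_ hlt' hy).1
    rw [Matrix.conjTranspose_eq_transpose_of_trivial, ← Matrix.mulVec_mulVec, h1, h2]

/-- Cauchy–Schwarz for `z = Aᵀ y`: `|z| ^ 4 = ⟨y, A z⟩ ^ 2 ≤ |y| ^ 2 * ρ |z| ^ 2`. -/
theorem contraction_transpose {A : Matrix (Fin n) (Fin n) ℝ} {ρ : ℝ} (hρ : 0 ≤ ρ)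
    (h1 : A.mulVec 1 = 1)
    (h : ∀ y : Fin n → ℝ, ∑ u, y u = 0 → ∑ u, A.mulVec y u ^ 2 ≤ ρ * ∑ u, y u ^ 2)
    {y : Fin n → ℝ} (hy : ∑ u, y u = 0) :
    ∑ u, A.transpose.mulVec y u ^ 2 ≤ ρ * ∑ u, y u ^ 2 := by
  set z := A.transpose.mulVec y with hz
  have hz0 : ∑ u, z u = 0 := by
    rw [hz, sum_mulVec_of_transpose (by rw [Matrix.transpose_transpose]; exact h1), hy]
  have h3 := h z hz0
  have h4 : ∑ u, z u ^ 2 = ∑ u, y u * A.mulVec z u := by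
    have := sum_sq_mulVec_eq A.transpose y
    rw [Matrix.transpose_transpose, ← Matrix.mulVec_mulVec, ← hz] at this
    rw [this, dotProduct]
  have h5 := Finset.sum_mul_sq_le_sq_mul_sq Finset.univ y (A.mulVec z)
  rw [← h4] at h5
  have hy2 : 0 ≤ ∑ u, y u ^ 2 := Finset.sum_nonneg fun u _ => sq_nonneg _
  have hz2 : 0 ≤ ∑ u, z u ^ 2 := Finset.sum_nonneg fun u _ => sq_nonneg _
  have h6 : (∑ u, z u ^ 2) * (∑ u, z u ^ 2) ≤ (ρ * ∑ u, y u ^ 2) * ∑ u, z u ^ 2 := by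
    nlinarith [mul_le_mul_of_nonneg_left h3 hy2]
  rcases hz2.eq_or_lt with h7 | h7
  · rw [← h7]; positivity
  · exact le_of_mul_le_mul_right h6 h7

theorem quadForm_circuit_step (t : ℕ) (h : Matrix (Fin n) (Fin n) ℝ) (y : Fin n → ℝ) :
    quadForm (kernelStep (circuit hd M) t h) y =
      quadForm h ((matchingMatrix (M ⟨t % d, Nat.mod_lt t hd⟩)).mulVec y) := by
  rw [quadForm_kernelStep, circuit, pmfAvg_pure]

/-- Here the first round acts on `y` first, which is the reverse of the order in the round matrix;
hence the transpose. -/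
theorem quadForm_kernelBack_circuit (j k : ℕ) (h : Matrix (Fin n) (Fin n) ℝ) (y : Fin n → ℝ) :
    quadForm (kernelBack (circuit hd M) (j * d) k h) y =
      quadForm h ((prefixMatrix hd M k).transpose.mulVec y) := by
  induction k generalizing h with
  | zero => simp [prefixMatrix, kernelBack]
  | succ k ih =>
    rw [kernelBack, ih, quadForm_circuit_step, prefixMatrix_succ, Matrix.transpose_mul,
      ← Matrix.mulVec_mulVec, matchingMatrix_transpose]
    simp only [Nat.mul_add_mod_self_right]

theorem quadForm_kernelForth_circuit (j k : ℕ) (y : Fin n → ℝ) :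
    quadForm (kernelForth (circuit hd M) (j * d + k)) y =
      quadForm (kernelForth (circuit hd M) (j * d)) ((prefixMatrix hd M k).mulVec y) := by
  induction k generalizing y with
  | zero => simp [prefixMatrix]
  | succ k ih =>
    rw [← add_assoc, kernelForth, quadForm_circuit_step, ih, prefixMatrix_succ,
      ← Matrix.mulVec_mulVec]
    simp only [Nat.mul_add_mod_self_right]

variable {hd M}

theorem contracts_kernelBack_periods (hn : 2 ≤ n) (hlt : roundLam (roundMatrix M) < 1)
    (j q : ℕ) {h : Matrix (Fin n) (Fin n) ℝ} {ρ : ℝ} (hρ : 0 ≤ ρ) (H : Contracts h ρ) :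
    Contracts (kernelBack (circuit hd M) (j * d) (q * d) h)
      ((roundLam (roundMatrix M) ^ 2) ^ q * ρ) := by
  induction q generalizing j with
  | zero => simpa [kernelBack] using H
  | succ q ih =>
    intro y hy
    rw [show (q + 1) * d = d + q * d by ring, kernelBack_comp, quadForm_kernelBack_circuit,
      prefixMatrix_period, show j * d + d = (j + 1) * d by ring]
    have h1 : (roundMatrix M).mulVec 1 = 1 := by
      rw [← prefixMatrix_period hd M]; exact prefixMatrix_mulVec_one hd M d
    have h2 : (roundMatrix M).transpose.mulVec 1 = 1 := by
      rw [← prefixMatrix_period hd M]; exact prefixMatrix_transpose_mulVec_one hd M d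
    refine (ih (j + 1) _ ?_).trans ?_
    · rw [sum_mulVec_of_transpose (by rw [Matrix.transpose_transpose]; exact h1), hy]
    · have h3 := contraction_transpose (sq_nonneg (roundLam (roundMatrix M))) h1
        (fun y hy => roundLam_contraction hn h1 h2 hlt hy) hy
      refine (mul_le_mul_of_nonneg_left h3 (by positivity)).trans (le_of_eq ?_)
      ring

theorem contracts_kernelForth_periods (hn : 2 ≤ n) (hlt : roundLam (roundMatrix M) < 1) (q : ℕ) :
    Contracts (kernelForth (circuit hd M) (q * d)) ((roundLam (roundMatrix M) ^ 2) ^ q) := by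
  induction q with
  | zero => rw [zero_mul, pow_zero]; exact contracts_one
  | succ q ih =>
    intro y hy
    rw [show (q + 1) * d = q * d + d by ring, quadForm_kernelForth_circuit, prefixMatrix_period]
    have h1 : (roundMatrix M).mulVec 1 = 1 := by
      rw [← prefixMatrix_period hd M]; exact prefixMatrix_mulVec_one hd M d
    have h2 : (roundMatrix M).transpose.mulVec 1 = 1 := by
      rw [← prefixMatrix_period hd M]; exact prefixMatrix_transpose_mulVec_one hd M d
    refine (ih _ ?_).trans ?_
    · rw [sum_mulVec_of_transpose h2, hy]
    · refine (mul_le_mul_of_nonneg_left (roundLam_contraction hn h1 h2 hlt hy)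
        (by positivity)).trans (le_of_eq ?_)
      ring

theorem Contracts.kernelForth_add {μ : ℕ → PMF (Matching G)} {ρ : ℝ} (hρ : 0 ≤ ρ) {t : ℕ}
    (H : Contracts (kernelForth μ t) ρ) (b : ℕ) : Contracts (kernelForth μ (t + b)) ρ := by
  induction b with
  | zero => exact H
  | succ b ih => exact ih.kernelStep μ hρ _

/-- A full period contracts by `a ^ 2 ≤ exp (-2 (1 - a))`. Up to two periods' worth of rounds are
wasted at the ends of a window, costing at most `2 * 2 (1 - a) ≤ 4` in the exponent. -/
theorem sq_pow_le_exp {a γ : ℝ} (h0 : 0 ≤ a) (h1 : a < 1) (hd : 0 < d)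
    (hγ : γ = 2 * (1 - a) / d) {q t : ℕ} (ht : t ≤ q * d + 2 * d) :
    (a ^ 2) ^ q ≤ Real.exp (4 - γ * t) := by
  have h2 : a ≤ Real.exp (-(1 - a)) := by
    have := Real.add_one_le_exp (-(1 - a)); linarith
  have h3 : (a ^ 2) ^ q ≤ Real.exp (-(2 * (1 - a) * q)) := by
    rw [← pow_mul]
    refine (pow_le_pow_left₀ h0 h2 _).trans (le_of_eq ?_)
    rw [← Real.exp_nat_mul]
    congr 1
    push_cast
    ring
  refine h3.trans (Real.exp_le_exp.2 ?_)
  have hd' : (0 : ℝ) < d := by exact_mod_cast hd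
  have ht' : (t : ℝ) ≤ (q + 2) * d := by
    have : (t : ℝ) ≤ q * d + 2 * d := by exact_mod_cast ht
    linarith
  have h4 : γ * t ≤ 2 * (1 - a) * (q + 2) := by
    rw [hγ, div_mul_eq_mul_div, div_le_iff₀ hd']
    nlinarith
  nlinarith

theorem contracts_kernelBack_circuit (hn : 2 ≤ n) (hlt : roundLam (roundMatrix M) < 1) {γ : ℝ}
    (hγ : γ = 2 * (1 - roundLam (roundMatrix M)) / d) (r L : ℕ) :
    Contracts (kernelBack (circuit hd M) r L 1) (Real.exp (4 - γ * L)) := by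
  have h0 := roundLam_nonneg (roundMatrix M)
  have hrd := Nat.div_add_mod r d
  have hrm := Nat.mod_lt r hd
  -- The window splits into `a` rounds up to a period boundary, `q` full periods and a remainder.
  -- The end pieces merely do not expand; `a = d` occurs when `r` is itself a boundary.
  obtain ⟨a, ha⟩ : ∃ a, r + a = (r / d + 1) * d := ⟨d - r % d, by
    rw [add_mul, one_mul, mul_comm]; omega⟩
  have had : a ≤ d := by
    rw [add_mul, one_mul, mul_comm] at ha; omega
  by_cases hL : L < a
  · have h1 := contracts_one.kernelBack (circuit hd M) zero_le_one r L (n := n)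
    refine h1.mono ?_
    simpa using sq_pow_le_exp h0 hlt hd hγ (q := 0) (t := L) (by omega)
  · set q := (L - a) / d with hq
    have hLd := Nat.div_add_mod (L - a) d
    have hLm := Nat.mod_lt (L - a) hd
    rw [← hq, mul_comm] at hLd
    have hLeq : L = a + (q * d + (L - a) % d) := by omega
    have h1 := contracts_one.kernelBack (circuit hd M) zero_le_one
      ((r / d + 1) * d + q * d) ((L - a) % d) (n := n)
    have h2 := contracts_kernelBack_periods (hd := hd) hn hlt (r / d + 1) q zero_le_one h1
    rw [← kernelBack_comp, ← ha] at h2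
    have h3 := h2.kernelBack (circuit hd M) (by positivity) r a
    rw [← kernelBack_comp, ← hLeq, mul_one] at h3
    exact h3.mono (sq_pow_le_exp h0 hlt hd hγ (by omega))

theorem contracts_kernelForth_circuit (hn : 2 ≤ n) (hlt : roundLam (roundMatrix M) < 1) {γ : ℝ}
    (hγ : γ = 2 * (1 - roundLam (roundMatrix M)) / d) (t : ℕ) :
    Contracts (kernelForth (circuit hd M) t) (Real.exp (4 - γ * t)) := by
  have h0 := roundLam_nonneg (roundMatrix M)
  have htd := Nat.div_add_mod t d
  have htm := Nat.mod_lt t hd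
  rw [mul_comm] at htd
  have h1 := (contracts_kernelForth_periods (hd := hd) hn hlt (t / d)).kernelForth_add
    (by positivity) (t % d)
  rw [htd] at h1
  exact h1.mono (sq_pow_le_exp h0 hlt hd hγ (by omega))

/-- The balancing circuit model. -/
theorem one_sub_le_prob_circuit (hn : Real.exp 10000 ≤ n) (hd : 0 < d)
    (hlt : roundLam (roundMatrix M) < 1) {ε : ℝ} (hε : ε < 1 / 2) {x : Fin n → ℤ}
    (hx : IsSparseLoad ε x) {κ : ℕ}
    (hκ : 25 * d * (Real.log n / (1 - roundLam (roundMatrix M))) ≤ κ) :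
    1 - 5 / (n : ℝ) ≤ prob (loadLaw (circuit hd M) x κ) {y | ∀ u, |y u| ≤ 1} := by
  have hn2' : (2 : ℝ) ≤ n := by linarith [Real.add_one_le_exp 10000]
  have hn2 : 2 ≤ n := by exact_mod_cast hn2'
  have hd1 : (1 : ℝ) ≤ d := by exact_mod_cast hd
  have h0 := roundLam_nonneg (roundMatrix M)
  set γ := 2 * (1 - roundLam (roundMatrix M)) / d with hγ
  have hg : 0 < 1 - roundLam (roundMatrix M) := by linarith
  have hlog : 0 ≤ Real.log n := Real.log_nonneg (by linarith)
  refine one_sub_le_prob_of_contracts hn _ (γ := γ) (by positivity) ?_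
    (contracts_kernelBack_circuit hn2 hlt hγ) (contracts_kernelForth_circuit hn2 hlt hγ) hε hx ?_
  · rw [hγ, div_le_iff₀ (by linarith)]
    linarith
  · refine le_trans ?_ hκ
    have e : Real.log n / γ = d * (Real.log n / (1 - roundLam (roundMatrix M))) / 2 := by
      rw [hγ]; field_simp
    rw [e]
    have : 0 ≤ d * (Real.log n / (1 - roundLam (roundMatrix M))) := by positivity
    nlinarith

end Circuit

/-! ### Mean-square contraction by independent random matchings -/

section MeanSquare

variable {n : ℕ} {G : SimpleGraph (Fin n)}

/-- The parallelogram law on each matched pair: the energy lost is the Dirichlet form of the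
matching. -/
theorem sum_sq_mulVec_add (M : Matching G) (y : Fin n → ℝ) :
    ∑ u, (matchingMatrix M).mulVec y u ^ 2 + (∑ u, (y u - y (partner M u)) ^ 2) / 4 =
      ∑ u, y u ^ 2 := by
  have h := sum_partner M (fun u => y u ^ 2)
  have e : ∀ u, (matchingMatrix M).mulVec y u ^ 2 + (y u - y (partner M u)) ^ 2 / 4 =
      y u ^ 2 / 2 + y (partner M u) ^ 2 / 2 := fun u => by
    rw [matchingMatrix_mulVec]; ring
  rw [Finset.sum_div, ← Finset.sum_add_distrib, Finset.sum_congr rfl fun u _ => e u,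
    Finset.sum_add_distrib, ← Finset.sum_div, ← Finset.sum_div, h]
  ring

open Classical in
theorem sum_sub_partner_sq (M : Matching G) (y : Fin n → ℝ) :
    ∑ u, (y u - y (partner M u)) ^ 2 =
      ∑ u, ∑ v, (y u - y v) ^ 2 * (if M.1.Adj u v then 1 else 0) := by
  refine Finset.sum_congr rfl fun u _ => ?_
  by_cases h : partner M u = u
  · rw [h, Finset.sum_eq_zero]
    · simp
    · intro v _
      by_cases hv : M.1.Adj u v
      · rw [← partner_eq_of_adj M hv, h]; simp
      · simp [hv]
  · rw [Finset.sum_eq_single (partner M u)]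
    · simp [adj_partner M h]
    · intro v _ hv
      rw [if_neg fun hh => hv (partner_eq_of_adj M hh).symm, mul_zero]
    · simp

open Classical in
theorem pmfAvg_indicator {α : Type*} [Fintype α] (q : PMF α) (S : Set α) :
    pmfAvg q (fun a => if a ∈ S then 1 else 0) = prob q S := by
  rw [prob, PMF.toOuterMeasure_apply_fintype, ENNReal.toReal_sum]
  · refine Finset.sum_congr rfl fun a _ => ?_
    by_cases h : a ∈ S <;> simp [h]
  · intro a _
    by_cases h : a ∈ S <;> simp [h, q.apply_ne_top]

variable {μ : ℕ → PMF (Matching G)} {δ : ℝ}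

theorem Contracts.kernelStep_mul
    (hμ : ∀ (t : ℕ) (y : Fin n → ℝ), ∑ u, y u = 0 →
      pmfAvg (μ t) (fun M => ∑ u, (matchingMatrix M).mulVec y u ^ 2) ≤ δ * ∑ u, y u ^ 2)
    {h : Matrix (Fin n) (Fin n) ℝ} {ρ : ℝ} (hρ : 0 ≤ ρ) (H : Contracts h ρ) (t : ℕ) :
    Contracts (MatchingModel.kernelStep μ t h) (δ * ρ) := fun y hy => by
  rw [quadForm_kernelStep]
  refine (pmfAvg_mono _ fun M => H _ (by rw [sum_mulVec, hy])).trans ?_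
  rw [pmfAvg_const_mul]
  refine (mul_le_mul_of_nonneg_left (hμ t y hy) hρ).trans (le_of_eq ?_)
  ring

theorem contracts_kernelBack_pow
    (hδ : 0 ≤ δ) (hμ : ∀ (t : ℕ) (y : Fin n → ℝ), ∑ u, y u = 0 →
      pmfAvg (μ t) (fun M => ∑ u, (matchingMatrix M).mulVec y u ^ 2) ≤ δ * ∑ u, y u ^ 2)
    (r L : ℕ) {h : Matrix (Fin n) (Fin n) ℝ} {ρ : ℝ} (hρ : 0 ≤ ρ) (H : Contracts h ρ) :
    Contracts (kernelBack μ r L h) (δ ^ L * ρ) := by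
  induction L generalizing h ρ with
  | zero => simpa [kernelBack] using H
  | succ L ih =>
    have := ih (mul_nonneg hδ hρ) (H.kernelStep_mul hμ hρ (r + L))
    rwa [← mul_assoc, ← pow_succ] at this

theorem contracts_kernelForth_pow
    (hδ : 0 ≤ δ) (hμ : ∀ (t : ℕ) (y : Fin n → ℝ), ∑ u, y u = 0 →
      pmfAvg (μ t) (fun M => ∑ u, (matchingMatrix M).mulVec y u ^ 2) ≤ δ * ∑ u, y u ^ 2)
    (t : ℕ) : Contracts (kernelForth μ t) (δ ^ t) := by
  induction t with
  | zero => rw [pow_zero]; exact contracts_one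
  | succ t ih =>
    rw [pow_succ']
    exact ih.kernelStep_mul hμ (pow_nonneg hδ t) t

end MeanSquare

/-! ### Regular graphs: Dirichlet form and spectral gap of the diffusion matrix -/

section Regular

variable {n d : ℕ} {G : SimpleGraph (Fin n)} [DecidableRel G.Adj]

/-- The sum of `f` over all ordered adjacent pairs. -/
def adjSum (G : SimpleGraph (Fin n)) [DecidableRel G.Adj] (f : Fin n → Fin n → ℝ) : ℝ :=
  ∑ u, ∑ v, if G.Adj u v then f u v else 0

theorem adjSum_nonneg {f : Fin n → Fin n → ℝ} (hf : ∀ u v, 0 ≤ f u v) : 0 ≤ adjSum G f :=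
  Finset.sum_nonneg fun u _ => Finset.sum_nonneg fun v _ => by
    have := hf u v
    positivity

theorem sum_adj_of_regular (hreg : G.IsRegularOfDegree d) (u : Fin n) (a : ℝ) :
    ∑ v, (if G.Adj u v then a else 0) = d * a := by
  rw [← Finset.sum_filter, Finset.sum_const, nsmul_eq_mul, ← hreg.degree_eq u,
    ← SimpleGraph.card_neighborFinset_eq_degree]
  congr 3
  ext v
  simp

theorem adjSum_left (hreg : G.IsRegularOfDegree d) (f : Fin n → ℝ) :
    adjSum G (fun u _ => f u) = d * ∑ u, f u := by
  simp only [adjSum, sum_adj_of_regular hreg, Finset.mul_sum]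

theorem adjSum_right (hreg : G.IsRegularOfDegree d) (f : Fin n → ℝ) :
    adjSum G (fun _ v => f v) = d * ∑ u, f u := by
  rw [← adjSum_left hreg, adjSum, adjSum, Finset.sum_comm]
  simp only [G.adj_comm]

theorem adjSum_add (f g : Fin n → Fin n → ℝ) :
    adjSum G (fun u v => f u v + g u v) = adjSum G f + adjSum G g := by
  simp only [adjSum, ← Finset.sum_add_distrib]
  exact Finset.sum_congr rfl fun u _ => Finset.sum_congr rfl fun v _ => by split_ifs <;> simp

theorem adjSum_const_mul (a : ℝ) (f : Fin n → Fin n → ℝ) :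
    adjSum G (fun u v => a * f u v) = a * adjSum G f := by
  simp only [adjSum, Finset.mul_sum]
  exact Finset.sum_congr rfl fun u _ => Finset.sum_congr rfl fun v _ => by split_ifs <;> simp

theorem diffusionMatrix_mulVec (hreg : G.IsRegularOfDegree d) (hd : 0 < d) (y : Fin n → ℝ)
    (u : Fin n) : (diffusionMatrix G).mulVec y u =
      y u / 2 + 1 / (2 * d) * ∑ v, if G.Adj u v then y v else 0 := by
  have : Nonempty (Fin n) := ⟨u⟩
  have hd' : (d : ℝ) ≠ 0 := by positivity
  have h : ∀ v, diffusionMatrix G u v * y v =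
      (if v = u then y v / 2 else 0) + 1 / (2 * d) * (if G.Adj u v then y v else 0) := by
    intro v
    simp only [diffusionMatrix, Matrix.of_apply, hreg.degree_eq, hreg.maxDegree_eq]
    by_cases h1 : u = v
    · subst h1
      simp
      field_simp
      ring
    · by_cases h2 : G.Adj u v <;> simp [h1, Ne.symm h1, h2]
  rw [Matrix.mulVec, dotProduct, Finset.sum_congr rfl fun v _ => h v, Finset.sum_add_distrib,
    ← Finset.mul_sum]
  simp

theorem diffusionMatrix_mulVec_one (hreg : G.IsRegularOfDegree d) (hd : 0 < d) :
    (diffusionMatrix G).mulVec 1 = 1 := by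
  funext u
  have hd' : (d : ℝ) ≠ 0 := by positivity
  rw [diffusionMatrix_mulVec hreg hd]
  simp only [Pi.one_apply, sum_adj_of_regular hreg]
  field_simp
  norm_num

theorem dotProduct_diffusionMatrix (hreg : G.IsRegularOfDegree d) (hd : 0 < d) (y : Fin n → ℝ) :
    y ⬝ᵥ (diffusionMatrix G).mulVec y =
      (∑ u, y u ^ 2) / 2 + 1 / (2 * d) * adjSum G (fun u v => y u * y v) := by
  simp only [dotProduct, diffusionMatrix_mulVec hreg hd, adjSum, Finset.sum_div, Finset.mul_sum,
    ← Finset.sum_add_distrib]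
  refine Finset.sum_congr rfl fun u _ => ?_
  rw [mul_add, Finset.mul_sum]
  congr 1
  · ring
  · exact Finset.sum_congr rfl fun v _ => by split_ifs <;> ring

theorem adjSum_sub_sq (hreg : G.IsRegularOfDegree d) (hd : 0 < d) (y : Fin n → ℝ) :
    adjSum G (fun u v => (y u - y v) ^ 2) =
      4 * d * (∑ u, y u ^ 2 - y ⬝ᵥ (diffusionMatrix G).mulVec y) := by
  have hd' : (d : ℝ) ≠ 0 := by positivity
  have e : (fun u v => (y u - y v) ^ 2) = fun u v => (y u ^ 2 + y v ^ 2) + (-2) * (y u * y v) := by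
    funext u v; ring
  rw [e, adjSum_add, adjSum_add, adjSum_const_mul, adjSum_left hreg (fun u => y u ^ 2),
    adjSum_right hreg (fun u => y u ^ 2), dotProduct_diffusionMatrix hreg hd]
  field_simp
  ring

theorem adjSum_add_sq (hreg : G.IsRegularOfDegree d) (hd : 0 < d) (y : Fin n → ℝ) :
    adjSum G (fun u v => (y u + y v) ^ 2) = 4 * d * (y ⬝ᵥ (diffusionMatrix G).mulVec y) := by
  have hd' : (d : ℝ) ≠ 0 := by positivity
  have e : (fun u v => (y u + y v) ^ 2) = fun u v => (y u ^ 2 + y v ^ 2) + 2 * (y u * y v) := by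
    funext u v; ring
  rw [e, adjSum_add, adjSum_add, adjSum_const_mul, adjSum_left hreg (fun u => y u ^ 2),
    adjSum_right hreg (fun u => y u ^ 2), dotProduct_diffusionMatrix hreg hd]
  field_simp
  ring

theorem eq_of_adjSum_sub_sq_eq_zero (hG : G.Connected) {y : Fin n → ℝ}
    (h : adjSum G (fun u v => (y u - y v) ^ 2) = 0) (u v : Fin n) : y u = y v := by
  have hadj : ∀ u v, G.Adj u v → y u = y v := by
    intro u v huv
    have h1 : ∀ u ∈ Finset.univ, 0 ≤ ∑ v, if G.Adj u v then (y u - y v) ^ 2 else 0 :=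
      fun u _ => Finset.sum_nonneg fun v _ => by positivity
    have h2 := (Finset.sum_eq_zero_iff_of_nonneg h1).1 h u (Finset.mem_univ u)
    have h3 := (Finset.sum_eq_zero_iff_of_nonneg fun v _ => by positivity).1 h2 v
      (Finset.mem_univ v)
    rw [if_pos huv] at h3
    exact sub_eq_zero.1 (pow_eq_zero_iff two_ne_zero |>.1 h3)
  obtain ⟨w⟩ := hG.preconnected u v
  induction w with
  | nil => rfl
  | cons hh _ ih => exact (hadj _ _ hh).trans ih

/-- The sums of `(y u + y v) ^ 2` and `(y u - y v) ^ 2` over edges put all eigenvalues in `[0, 1]`.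
By connectedness eigenvalue 1 has only constant eigenvectors, and two constant unit vectors cannot
be orthogonal. -/
theorem lam_diffusionMatrix_lt_one (hn : 2 ≤ n) (hG : G.Connected) (hreg : G.IsRegularOfDegree d)
    (hd : 0 < d) : lam (diffusionMatrix G) (diffusionMatrix_isHermitian G) < 1 := by
  obtain ⟨l, v, i₀, hv, horth, -, hmax, -, i, hi, hlam⟩ :=
    exists_orthonormal_eigenvectors (diffusionMatrix_isHermitian G) hn
  have hd' : (0 : ℝ) < d := by exact_mod_cast hd
  have hform : ∀ j, v j ⬝ᵥ (diffusionMatrix G).mulVec (v j) = l j := fun j => by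
    rw [hv, dotProduct_smul, horth, if_pos rfl, smul_eq_mul, mul_one]
  have hnorm : ∀ j, ∑ u, v j u ^ 2 = 1 := fun j => by
    have := horth j j
    rw [if_pos rfl, dotProduct] at this
    rw [← this]
    exact Finset.sum_congr rfl fun u _ => sq _
  have hl0 : ∀ j, 0 ≤ l j := fun j => by
    have h1 := adjSum_add_sq hreg hd (v j)
    have h2 : 0 ≤ adjSum G (fun a b => (v j a + v j b) ^ 2) := adjSum_nonneg fun _ _ => sq_nonneg _
    rw [h1, hform] at h2
    exact nonneg_of_mul_nonneg_right h2 (by positivity)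
  have hl1 : ∀ j, l j ≤ 1 := fun j => by
    have h1 := adjSum_sub_sq hreg hd (v j)
    have h2 : 0 ≤ adjSum G (fun a b => (v j a - v j b) ^ 2) := adjSum_nonneg fun _ _ => sq_nonneg _
    rw [h1, hform, hnorm] at h2
    linarith [nonneg_of_mul_nonneg_right h2 (by positivity)]
  by_contra hge
  rw [hlam, abs_of_nonneg (hl0 i), not_lt] at hge
  have hconst : ∀ j, l j = 1 → ∀ a b, v j a = v j b := fun j hj =>
    eq_of_adjSum_sub_sq_eq_zero hG (by rw [adjSum_sub_sq hreg hd, hform, hnorm, hj]; ring)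
  have hci := hconst i (le_antisymm (hl1 i) hge)
  have hc0 := hconst i₀ (le_antisymm (hl1 i₀) (hge.trans (hmax i)))
  have ho := horth i i₀
  rw [if_neg hi, dotProduct] at ho
  have hni := hnorm i
  have hn0 := hnorm i₀
  rw [Finset.sum_congr rfl fun u _ => by rw [hci u i₀, hc0 u i₀]] at ho
  rw [Finset.sum_congr rfl fun u _ => by rw [hci u i₀]] at hni
  rw [Finset.sum_congr rfl fun u _ => by rw [hc0 u i₀]] at hn0
  simp only [Finset.sum_const, Finset.card_univ, nsmul_eq_mul] at ho hni hn0
  rcases mul_eq_zero.1 ho with h | h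
  · rw [h] at hni; simp at hni
  · rcases mul_eq_zero.1 h with h | h
    · rw [h] at hni; simp at hni
    · rw [h] at hn0; simp at hn0

/-- One random matching contracts vectors orthogonal to the constants in mean square. -/
theorem pmfAvg_sum_sq_le (hn : 2 ≤ n) (hG : G.Connected) (hreg : G.IsRegularOfDegree d)
    (hd : 0 < d) {p : ℝ} (hp : 0 ≤ p) (q : PMF (Matching G))
    (hq : ∀ u v, G.Adj u v → p / (d : ℝ) ≤ prob q {M | M.1.Adj u v}) {y : Fin n → ℝ}
    (hy : ∑ u, y u = 0) :
    pmfAvg q (fun M => ∑ u, (matchingMatrix M).mulVec y u ^ 2) ≤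
      (1 - p * (1 - lam (diffusionMatrix G) (diffusionMatrix_isHermitian G))) *
        ∑ u, y u ^ 2 := by
  classical
  have hd' : (0 : ℝ) < d := by exact_mod_cast hd
  have h1 : pmfAvg q (fun M => ∑ u, (matchingMatrix M).mulVec y u ^ 2) =
      ∑ u, y u ^ 2 + (-1 / 4) * ∑ u, ∑ v, (y u - y v) ^ 2 * prob q {M | M.1.Adj u v} := by
    have e : (fun M : Matching G => ∑ u, (matchingMatrix M).mulVec y u ^ 2) = fun M =>
        ∑ u, y u ^ 2 + (-1 / 4) * ∑ u, ∑ v, (y u - y v) ^ 2 *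
          (if M ∈ {M : Matching G | M.1.Adj u v} then 1 else 0) := by
      funext M
      have h2 := sum_sq_mulVec_add M y
      rw [sum_sub_partner_sq] at h2
      simp only [Set.mem_ofPred_eq]
      linarith
    rw [e, pmfAvg_add, pmfAvg_const, pmfAvg_const_mul, pmfAvg_sum]
    simp only [pmfAvg_sum, pmfAvg_const_mul, pmfAvg_indicator]
  -- Each edge is matched with probability at least `p / d`, so the expected Dirichlet form of the
  -- matching dominates `p / d` times that of `G`, which is `4 d (|y| ^ 2 - ⟨y, P y⟩)`.
  have h2 : p / d * adjSum G (fun u v => (y u - y v) ^ 2) ≤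
      ∑ u, ∑ v, (y u - y v) ^ 2 * prob q {M | M.1.Adj u v} := by
    rw [adjSum, Finset.mul_sum]
    refine Finset.sum_le_sum fun u _ => ?_
    rw [Finset.mul_sum]
    refine Finset.sum_le_sum fun v _ => ?_
    split_ifs with h
    · rw [mul_comm]
      exact mul_le_mul_of_nonneg_left (hq u v h) (sq_nonneg _)
    · rw [mul_zero]
      exact mul_nonneg (sq_nonneg _) ENNReal.toReal_nonneg
  rw [adjSum_sub_sq hreg hd] at h2
  have h3 := (lam_contraction (diffusionMatrix_isHermitian G) hn
    (diffusionMatrix_mulVec_one hreg hd) (lam_diffusionMatrix_lt_one hn hG hreg hd) hy).1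
  have h4 : p / d * (4 * d * (∑ u, y u ^ 2 - y ⬝ᵥ (diffusionMatrix G).mulVec y)) =
      4 * (p * (∑ u, y u ^ 2 - y ⬝ᵥ (diffusionMatrix G).mulVec y)) := by
    field_simp
  rw [h4] at h2
  rw [h1]
  have h5 := mul_le_mul_of_nonneg_left h3 hp
  linarith

/-- The random matching model. -/
theorem one_sub_le_prob_random (hn : Real.exp 10000 ≤ n) (hG : G.Connected)
    (hreg : G.IsRegularOfDegree d) {p : ℝ} (hp : 0 < p) (hp1 : p ≤ 1)
    (μ : ℕ → PMF (Matching G))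
    (hμ : ∀ t u v, G.Adj u v → p / (d : ℝ) ≤ prob (μ t) {M | M.1.Adj u v}) {ε : ℝ}
    (hε : ε < 1 / 2) {x : Fin n → ℤ} (hx : IsSparseLoad ε x) {κ : ℕ}
    (hκ : 25 / p * (Real.log n /
      (1 - lam (diffusionMatrix G) (diffusionMatrix_isHermitian G))) ≤ κ) :
    1 - 5 / (n : ℝ) ≤ prob (loadLaw μ x κ) {y | ∀ u, |y u| ≤ 1} := by
  have hn2' : (2 : ℝ) ≤ n := by linarith [Real.add_one_le_exp 10000]
  have hn2 : 2 ≤ n := by exact_mod_cast hn2'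
  have hd : 0 < d := by
    have : Nontrivial (Fin n) := Fin.nontrivial_iff_two_le.2 hn2
    have := hG.preconnected.degree_pos_of_nontrivial (⟨0, by omega⟩ : Fin n)
    rwa [hreg.degree_eq] at this
  set l := lam (diffusionMatrix G) (diffusionMatrix_isHermitian G) with hl
  have hl1 : l < 1 := lam_diffusionMatrix_lt_one hn2 hG hreg hd
  have hl0 : 0 ≤ l := lam_nonneg _
  have hγ : 0 < p * (1 - l) := mul_pos hp (by linarith)
  have hγ1 : p * (1 - l) ≤ 1 := by nlinarith
  have hδ : 0 ≤ 1 - p * (1 - l) := by linarith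
  have hcontr := fun t (y : Fin n → ℝ) (hy : ∑ u, y u = 0) =>
    pmfAvg_sum_sq_le hn2 hG hreg hd hp.le (μ t) (hμ t) hy
  have hexp : ∀ t : ℕ, (1 - p * (1 - l)) ^ t ≤ Real.exp (4 - p * (1 - l) * t) := by
    intro t
    refine (pow_le_pow_left₀ hδ (Real.one_sub_le_exp_neg _) t).trans ?_
    rw [← Real.exp_nat_mul]
    refine Real.exp_le_exp.2 ?_
    linarith
  refine one_sub_le_prob_of_contracts hn μ hγ (by linarith) (fun r L => ?_) (fun t => ?_) hε hx ?_
  · refine (contracts_kernelBack_pow hδ hcontr r L zero_le_one contracts_one).mono ?_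
    rw [mul_one]
    exact hexp L
  · exact (contracts_kernelForth_pow hδ hcontr t).mono (hexp t)
  · refine le_trans (le_of_eq ?_) hκ
    rw [div_mul_div_comm, mul_div_assoc]

end Regular

end MatchingModel

/-! ### The two models together -/

theorem mainTheorem10 :
    ∃ ε₀ : ℝ, 0 < ε₀ ∧
      -- random matching model
      (∀ p : ℝ, 0 < p → ∃ C : ℝ, 0 < C ∧ ∃ N : ℕ, ∀ ε : ℝ, 0 < ε → ε < ε₀ →
        ∀ n : ℕ, N ≤ n → ∀ (d : ℕ) (G : SimpleGraph (Fin n)) [DecidableRel G.Adj],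
          G.Connected → G.IsRegularOfDegree d →
          ∀ μ : ℕ → PMF (MatchingModel.Matching G),
            (∀ t u v, G.Adj u v → p / (d : ℝ) ≤ MatchingModel.prob (μ t) {M | M.1.Adj u v}) →
            ∀ x₀ : Fin n → ℤ, MatchingModel.IsSparseLoad ε x₀ →
              ∀ κ : ℕ,
                C * (Real.log n /
                  (1 - MatchingModel.lam (MatchingModel.diffusionMatrix G)
                    (MatchingModel.diffusionMatrix_isHermitian G))) ≤ (κ : ℝ) →
                1 - 5 / (n : ℝ) ≤
                  MatchingModel.prob (MatchingModel.loadLaw μ x₀ κ) {x | ∀ u, |x u| ≤ 1}) ∧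
      -- balancing circuit model with a constant number `d` of matchings
      (∀ (d : ℕ) (hd : 0 < d), ∃ C : ℝ, 0 < C ∧ ∃ N : ℕ, ∀ ε : ℝ, 0 < ε → ε < ε₀ →
        ∀ n : ℕ, N ≤ n → ∀ (G : SimpleGraph (Fin n)) (M : Fin d → MatchingModel.Matching G),
          MatchingModel.roundLam (MatchingModel.roundMatrix M) < 1 →
          ∀ x₀ : Fin n → ℤ, MatchingModel.IsSparseLoad ε x₀ →
            ∀ κ : ℕ,
              C * (Real.log n /
                (1 - MatchingModel.roundLam (MatchingModel.roundMatrix M))) ≤ (κ : ℝ) →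
              1 - 5 / (n : ℝ) ≤
                MatchingModel.prob (MatchingModel.loadLaw (MatchingModel.circuit hd M) x₀ κ)
                  {x | ∀ u, |x u| ≤ 1}) := by
  refine ⟨1 / 2, by norm_num, fun p hp => ?_, fun d hd => ?_⟩
  -- Replacing `p` by `min p 1` only weakens the edge hypothesis and keeps the contraction factor `1
  -- - p (1 - λ)` non-negative. The threshold `exp 10000` ensures `√(log n) ≥ 100`.
  · have hp' : 0 < min p 1 := lt_min hp one_pos
    refine ⟨25 / min p 1, by positivity, ⌈Real.exp 10000⌉₊, ?_⟩
    intro ε _ hε n hn d G _ hG hreg μ hμ x₀ hx κ hκ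
    refine MatchingModel.one_sub_le_prob_random (Nat.ceil_le.1 hn) hG hreg hp' (min_le_right _ _)
      μ (fun t u v huv => (div_le_div_of_nonneg_right (min_le_left _ _) ?_).trans (hμ t u v huv))
      hε hx hκ
    positivity
  · refine ⟨25 * d, by positivity, ⌈Real.exp 10000⌉₊, ?_⟩
    intro ε _ hε n hn G M hlt x₀ hx κ hκ
    exact MatchingModel.one_sub_le_prob_circuit (Nat.ceil_le.1 hn) hd hlt hε hx hκ
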